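/- Let $K$ be a finite triangulation of a closed connected oriented surface $M$, with its vertices linearly ordered, and let $C^j(K)$ be the simplicial $j$-cochains with values in $\mathbb{C}$, with coboundary $\delta$. For $\sigma,\tau\in C^1(K)$ let $\sigma\cup\tau=R(W\sigma\wedge W\tau)\in C^2(K)$, where $W$ is the ($\mathbb{C}$-linear) Whitney map, sending the edge $[p,q]$ to the form $\mu_p\,d\mu_q-\mu_q\,d\mu_p$ in barycentric coordinates, and $R$ is integration over the triangles of $K$. Let $\langle\cdot,\cdot\rangle$ be a positive definite hermitian inner product on $\bigoplus_j C^j(K)$ (antilinear in the second argument) for which different degrees are orthogonal and which on $C^1(K)$ is the hermitian extension of a real inner product on the real $1$-cochains, i.e. $\langle\bar a,\bar b\rangle=\overline{\langle a,b\rangle}$ for $a,b\in C^1(K)$. Let $\delta^*$ be the adjoint of $\delta$, let $H^1=\{a\in C^1(K): (\delta^*\delta+\delta\delta^*)a=\delta a=\delta^*a=0\}$ be the space of harmonic $1$-cochains, let $\bigstar:C^1(K)\to C^1(K)$ be defined by $\langle\bigstar a,b\rangle=(a\cup\bar b)[M]$, and let $\bigstar_H:H^1\to H^1$ be the induced operator,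 i.e. $\bigstar$ followed by the orthogonal projection onto $H^1$. The space $\mathcal{H}^{1,0}$ of holomorphic $1$-cochains is the linear span of all $\sigma\in H^1$ with $\bigstar_H\sigma=-i\lambda\sigma$ for some real $\lambda\ge 0$. Let $a_1,\dots,a_g,b_1,\dots,b_g$ be integral simplicial $1$-cycles of $K$ whose classes form a canonical basis of $H_1(K;\mathbb{Z})$, i.e. a basis with intersection numbers $a_i\cdot b_j=\delta_{ij}$ and $a_i\cdot a_j=b_i\cdot b_j=0$. (Here $c\cdot c'=(\eta_c\cup\eta_{c'})[M]$, where the closed $1$-cochain $\eta_c$ is Poincaré dual to the cycle $c$: $\alpha(c)=(\alpha\cup\eta_c)[M]$ for every closed $1$-cochain $\alpha$.) Then there is a unique basis $\sigma_1,\dots,\sigma_g$ of $\mathcal{H}^{1,0}$ with $\sigma_i(a_j)=\delta_{ij}$ (the canonical basis), and the combinatorial period matrix $\Pi=(\sigma_i(b_j))_{1\le i,j\le g}$ is symmetric with positive definite imaginary part $\operatorname{Im}\Pi$. -/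

import Mathlib

open scoped ComplexConjugate

noncomputable section

/-! ### Simplices, chains, cochains -/

/-- The `j`-simplices of an abstract simplicial complex. The vertices are linearly ordered, and
every simplex carries the orientation given by its vertices in increasing order. -/
def Simplex {V : Type*} (K : AbstractSimplicialComplex V) (j : ℕ) : Type _ :=
  {s : Finset V // s ∈ K.faces ∧ s.card = j + 1}

instance {V : Type*} (K : AbstractSimplicialComplex V) (j : ℕ) : DecidableEq (Simplex K j) :=
  Classical.decEq _

instance {V : Type*} [Fintype V] (K : AbstractSimplicialComplex V) (j : ℕ) :
    Fintype (Simplex K j) :=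
  letI : Finite (Simplex K j) := Subtype.finite
  Fintype.ofFinite _

/-- The face `[p₀, …, p̂ᵢ, …, p_{j+1}]` of the simplex `[p₀, …, p_{j+1}]`, `p₀ < ⋯ < p_{j+1}`. -/
def Simplex.face {V : Type*} [LinearOrder V] {K : AbstractSimplicialComplex V} {j : ℕ}
    (s : Simplex K (j + 1)) (i : Fin (j + 2)) : Simplex K j :=
  ⟨s.1.erase (s.1.orderEmbOfFin s.2.2 i), by
    have hmem := s.1.orderEmbOfFin_mem s.2.2 i
    have hc : (s.1.erase (s.1.orderEmbOfFin s.2.2 i)).card = j + 1 := by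
      rw [Finset.card_erase_of_mem hmem, s.2.2]; rfl
    exact ⟨(K.isRelLowerSet_faces s.2.1).2 (Finset.erase_subset _ _)
      (Finset.card_pos.mp (by omega)), hc⟩⟩

/-- Simplicial cochains of degree `j` with complex values. -/
abbrev Cochain {V : Type*} (K : AbstractSimplicialComplex V) (j : ℕ) : Type _ :=
  Simplex K j → ℂ

/-- Simplicial chains of degree `j` with integer coefficients. -/
abbrev Chain {V : Type*} (K : AbstractSimplicialComplex V) (j : ℕ) : Type _ :=
  Simplex K j → ℤ

section Surface

variable {V : Type*} [Fintype V] [LinearOrder V]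

/-- The simplicial coboundary `δ : C^j → C^{j+1}`. -/
def coboundary (K : AbstractSimplicialComplex V) (j : ℕ) :
    Cochain K j →ₗ[ℂ] Cochain K (j + 1) where
  toFun f s := ∑ i : Fin (j + 2), (-1 : ℂ) ^ (i : ℕ) * f (s.face i)
  map_add' f g := by
    funext s; simp [mul_add, Finset.sum_add_distrib]
  map_smul' r f := by
    funext s; simp [Finset.mul_sum, mul_left_comm]

/-- The simplicial boundary `∂ : C_{j+1} → C_j`; the coefficient of `∂ c` at `s` collects the
simplices `t` having `s` as a face. -/
def boundary (K : AbstractSimplicialComplex V) (j : ℕ) :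
    Chain K (j + 1) →ₗ[ℤ] Chain K j where
  toFun c s := ∑ t : Simplex K (j + 1), ∑ i : Fin (j + 2),
    if t.face i = s then (-1 : ℤ) ^ (i : ℕ) * c t else 0
  map_add' c d := by
    funext s
    simp only [Pi.add_apply, ← Finset.sum_add_distrib]
    refine Finset.sum_congr rfl fun t _ => Finset.sum_congr rfl fun i _ => ?_
    split_ifs <;> ring
  map_smul' r c := by
    funext s
    simp only [Pi.smul_apply, smul_eq_mul, eq_intCast, Int.cast_id, Finset.mul_sum]
    refine Finset.sum_congr rfl fun t _ => Finset.sum_congr rfl fun i _ => ?_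
    split_ifs <;> ring

/-- The value `f(c)` of a cochain on a chain. -/
def Cochain.eval {K : AbstractSimplicialComplex V} {j : ℕ} (f : Cochain K j) (c : Chain K j) : ℂ :=
  ∑ s : Simplex K j, (c s : ℂ) * f s

/-! ### Triangulated closed oriented surfaces -/

/-- The `1`-skeleton of a complex. -/
def oneSkeleton (K : AbstractSimplicialComplex V) : SimpleGraph V where
  Adj u v := u ≠ v ∧ ({u, v} : Finset V) ∈ K.faces
  symm := ⟨fun u v h => ⟨h.1.symm, by rw [Finset.pair_comm]; exact h.2⟩⟩
  loopless := ⟨fun _ h => h.1 rfl⟩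

/-- The `1`-skeleton of the link of the vertex `v`: its vertices are the neighbours `w` of `v`,
and `w`, `w'` are joined when `v`, `w`, `w'` span a triangle. -/
def linkGraph (K : AbstractSimplicialComplex V) (v : V) :
    SimpleGraph {w : V // v ≠ w ∧ ({v, w} : Finset V) ∈ K.faces} where
  Adj w w' := w ≠ w' ∧ ({v, w.1, w'.1} : Finset V) ∈ K.faces
  symm := ⟨fun w w' h => ⟨h.1.symm, by rw [Finset.pair_comm]; exact h.2⟩⟩
  loopless := ⟨fun _ h => h.1 rfl⟩

variable (V) in
/-- A triangulated closed (connected, oriented) surface: a finite connected simplicial complex of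
dimension at most two in which the link of every vertex is a cycle (a connected graph with all
degrees two), with an orientation, i.e. a fundamental cycle `[M]` in which every triangle has
coefficient `1` or `-1`. -/
structure TriangulatedSurface where
  /-- the underlying simplicial complex -/
  K : AbstractSimplicialComplex V
  card_le_three : ∀ s ∈ K.faces, s.card ≤ 3
  connected : (oneSkeleton K).Connected
  link_connected : ∀ v, (linkGraph K v).Connected
  link_degree : ∀ v w, ((linkGraph K v).neighborSet w).ncard = 2
  /-- the fundamental cycle -/
  fundamentalCycle : Chain K 2
  fundamentalCycle_coeff : ∀ t, fundamentalCycle t = 1 ∨ fundamentalCycle t = -1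
  boundary_fundamentalCycle : boundary K 1 fundamentalCycle = 0

/-! ### The cochain product induced by Whitney forms -/

/-- Barycentric coordinates `μ₀, μ₁, μ₂` on the standard triangle `0 ≤ x, 0 ≤ y, x + y ≤ 1`. -/
def bary (i : Fin 3) (x y : ℝ) : ℝ := ![1 - x - y, x, y] i

/-- The coefficients of the constant `1`-form `dμᵢ` in the basis `dx, dy`. -/
def dbary (i : Fin 3) (k : Fin 2) : ℝ := ![![-1, -1], ![1, 0], ![0, 1]] i k

/-- The coefficients at `(x, y)` of the elementary Whitney form `μᵢ dμⱼ - μⱼ dμᵢ` of the edge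
`[pᵢ, pⱼ]` of a triangle. -/
def whitneyEdge (i j : Fin 3) (x y : ℝ) (k : Fin 2) : ℝ :=
  bary i x y * dbary j k - bary j x y * dbary i k

/-- The coefficients of the Whitney form `W σ` on the triangle `t = [p₀, p₁, p₂]`, `p₀ < p₁ < p₂`,
which is parametrized affinely by the standard triangle. The edge opposite to `pᵢ` is `t.face i`;
the elementary forms of all other edges vanish on `t`. -/
def whitneyForm {K : AbstractSimplicialComplex V} (σ : Cochain K 1) (t : Simplex K 2)
    (x y : ℝ) (k : Fin 2) : ℂ :=
  σ (t.face 2) * whitneyEdge 0 1 x y k + σ (t.face 1) * whitneyEdge 0 2 x y k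
    + σ (t.face 0) * whitneyEdge 1 2 x y k

/-- The cochain product `σ ∪ τ = R (W σ ∧ W τ)` of two `1`-cochains, where `R` integrates
`2`-forms over the triangles `[p₀, p₁, p₂]`; it is complex bilinear. -/
def cup {K : AbstractSimplicialComplex V} (σ τ : Cochain K 1) : Cochain K 2 := fun t =>
  ∫ x in (0 : ℝ)..1, ∫ y in (0 : ℝ)..(1 - x),
    (whitneyForm σ t x y 0 * whitneyForm τ t x y 1 - whitneyForm σ t x y 1 * whitneyForm τ t x y 0)

/-- The integral of an affine function over an interval. -/
theorem integral_affine (P Q : ℂ) (a : ℝ) :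
    (∫ y in (0 : ℝ)..a, (P + Q * (y : ℂ))) = P * a + Q * (a : ℂ) ^ 2 / 2 := by
  have h : ∀ y ∈ Set.uIcc (0 : ℝ) a,
      HasDerivAt (fun y : ℝ => P * (y : ℂ) + Q * (y : ℂ) ^ 2 / 2) (P + Q * (y : ℂ)) y := by
    intro y _
    have h1 : HasDerivAt (fun z : ℂ => P * z + Q * z ^ 2 / 2) (P + Q * (y : ℂ)) (y : ℂ) := by
      have := ((hasDerivAt_id (y : ℂ)).const_mul P).add
        ((((hasDerivAt_id (y : ℂ)).pow 2).const_mul Q).div_const 2)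
      refine this.congr_deriv ?_
      simp only [id_eq, Nat.cast_ofNat]
      norm_num
      ring
    exact h1.comp_ofReal
  rw [intervalIntegral.integral_eq_sub_of_hasDerivAt h
    (Continuous.intervalIntegrable (by fun_prop) _ _)]
  simp

/-- The integral of a quadratic function over the unit interval. -/
theorem integral_quadratic (P Q R : ℂ) :
    (∫ y in (0 : ℝ)..1, (P + Q * (y : ℂ) + R * (y : ℂ) ^ 2)) = P + Q / 2 + R / 3 := by
  have h : ∀ y ∈ Set.uIcc (0 : ℝ) 1,
      HasDerivAt (fun y : ℝ => P * (y : ℂ) + Q * (y : ℂ) ^ 2 / 2 + R * (y : ℂ) ^ 3 / 3)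
        (P + Q * (y : ℂ) + R * (y : ℂ) ^ 2) y := by
    intro y _
    have h1 : HasDerivAt (fun z : ℂ => P * z + Q * z ^ 2 / 2 + R * z ^ 3 / 3)
        (P + Q * (y : ℂ) + R * (y : ℂ) ^ 2) (y : ℂ) := by
      have := (((hasDerivAt_id (y : ℂ)).const_mul P).add
        ((((hasDerivAt_id (y : ℂ)).pow 2).const_mul Q).div_const 2)).add
        ((((hasDerivAt_id (y : ℂ)).pow 3).const_mul R).div_const 3)
      refine this.congr_deriv ?_
      simp only [id_eq, Nat.cast_ofNat]
      norm_num
      ring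
    exact h1.comp_ofReal
  rw [intervalIntegral.integral_eq_sub_of_hasDerivAt h
    (Continuous.intervalIntegrable (by fun_prop) _ _)]
  simp

/-- Evaluation of the integral defining `cup`. -/
theorem cup_apply {K : AbstractSimplicialComplex V} (σ τ : Cochain K 1) (t : Simplex K 2) :
    cup σ τ t = (1 / 6 : ℂ) *
      ((σ (t.face 2) * τ (t.face 0) - σ (t.face 0) * τ (t.face 2))
        + (σ (t.face 2) * τ (t.face 1) - σ (t.face 1) * τ (t.face 2))
        + (σ (t.face 1) * τ (t.face 0) - σ (t.face 0) * τ (t.face 1))) := by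
  set s₂ := σ (t.face 2) with hs₂
  set s₁ := σ (t.face 1) with hs₁
  set s₀ := σ (t.face 0) with hs₀
  set r₂ := τ (t.face 2) with hr₂
  set r₁ := τ (t.face 1) with hr₁
  set r₀ := τ (t.face 0) with hr₀
  set A : ℂ := s₂ * r₁ - s₁ * r₂ with hA
  set B : ℂ := s₂ * r₀ - s₀ * r₂ with hB
  set C : ℂ := s₁ * r₀ - s₀ * r₁ with hC
  have key : ∀ x y : ℝ, whitneyForm σ t x y 0 * whitneyForm τ t x y 1
      - whitneyForm σ t x y 1 * whitneyForm τ t x y 0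
      = (A + (B - A) * (x : ℂ)) + (C - A) * (y : ℂ) := by
    intro x y
    simp only [whitneyForm, whitneyEdge, bary, dbary, ← hs₂, ← hs₁, ← hs₀, ← hr₂, ← hr₁, ← hr₀,
      hA, hB, hC]
    simp
    ring
  have hquad : ∀ x : ℝ, (A + (B - A) * (x : ℂ)) * ((1 - x : ℝ) : ℂ)
      + (C - A) * ((1 - x : ℝ) : ℂ) ^ 2 / 2
      = (A + (C - A) / 2) + (B - A - C) * (x : ℂ) + ((C + A) / 2 - B) * (x : ℂ) ^ 2 := by
    intro x
    push_cast
    ring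
  simp only [cup, key, integral_affine, hquad, integral_quadratic]
  ring

/-- The cochain product is linear in the first factor. -/
theorem cup_add_left {K : AbstractSimplicialComplex V} (σ σ' τ : Cochain K 1) :
    cup (σ + σ') τ = cup σ τ + cup σ' τ := by
  funext t; simp only [cup_apply, Pi.add_apply]; ring

theorem cup_smul_left {K : AbstractSimplicialComplex V} (r : ℂ) (σ τ : Cochain K 1) :
    cup (r • σ) τ = r • cup σ τ := by
  funext t; simp only [cup_apply, Pi.smul_apply, smul_eq_mul]; ring

theorem cup_add_right {K : AbstractSimplicialComplex V} (σ τ τ' : Cochain K 1) :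
    cup σ (τ + τ') = cup σ τ + cup σ τ' := by
  funext t; simp only [cup_apply, Pi.add_apply]; ring

theorem cup_smul_right {K : AbstractSimplicialComplex V} (r : ℂ) (σ τ : Cochain K 1) :
    cup σ (r • τ) = r • cup σ τ := by
  funext t; simp only [cup_apply, Pi.smul_apply, smul_eq_mul]; ring

theorem Cochain.eval_add {K : AbstractSimplicialComplex V} {j : ℕ} (f g : Cochain K j)
    (c : Chain K j) : (f + g).eval c = f.eval c + g.eval c := by
  simp [Cochain.eval, mul_add, Finset.sum_add_distrib]

theorem Cochain.eval_smul {K : AbstractSimplicialComplex V} {j : ℕ} (r : ℂ) (f : Cochain K j)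
    (c : Chain K j) : (r • f).eval c = r * f.eval c := by
  simp [Cochain.eval, Finset.mul_sum, mul_left_comm]

/-! ### Hermitian inner products on cochains and the induced operators -/

/-- The antilinear functionals on a complex vector space. -/
abbrev AntiDual (E : Type*) [AddCommGroup E] [Module ℂ E] : Type _ := E →ₗ⋆[ℂ] ℂ

/-- Riesz representation for a positive definite hermitian form, linear in the first argument and
antilinear in the second one, on a finite-dimensional complex vector space. -/
theorem riesz_bijective {E : Type*} [AddCommGroup E] [Module ℂ E] [FiniteDimensional ℂ E]
    (B : E →ₗ[ℂ] AntiDual E) (hsymm : ∀ a b, conj (B b a) = B a b)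
    (hpos : ∀ a, a ≠ 0 → 0 < (B a a).re) : Function.Bijective B := by
  constructor
  · refine (injective_iff_map_eq_zero B).2 fun a ha => ?_
    by_contra hne
    have := hpos a hne
    rw [ha] at this
    simp at this
  · let core : InnerProductSpace.Core ℂ E :=
      { inner := fun x y => B y x
        conj_inner_symm := fun x y => hsymm y x
        re_inner_nonneg := fun x => by
          by_cases hx : x = 0
          · simp [hx]
          · exact (hpos x hx).le
        add_left := fun x y z => by simp
        smul_left := fun x y r => by simp
        definite := fun x hx => by
          by_contra hne
          have h := hpos x hne
          have hx' : B x x = 0 := hx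
          simp [hx'] at h }
    let _ : NormedAddCommGroup E := core.toNormedAddCommGroup
    let _ : InnerProductSpace ℂ E := InnerProductSpace.ofCore core.toCore
    have : CompleteSpace E := FiniteDimensional.complete ℂ E
    intro ψ
    let φ : E →ₗ[ℂ] ℂ :=
      { toFun := fun b => conj (ψ b)
        map_add' := fun x y => by simp
        map_smul' := fun r x => by simp }
    refine ⟨(InnerProductSpace.toDual ℂ E).symm (LinearMap.toContinuousLinearMap φ), ?_⟩
    ext b
    have h := InnerProductSpace.toDual_symm_apply (𝕜 := ℂ) (E := E) (x := b)
      (y := LinearMap.toContinuousLinearMap φ)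
    have h2 : B b ((InnerProductSpace.toDual ℂ E).symm (LinearMap.toContinuousLinearMap φ))
        = conj (ψ b) := h
    rw [← hsymm, h2]
    simp

/-- A positive definite hermitian inner product on the complex simplicial cochains for which
cochains of different degrees are orthogonal, that is, one inner product in every degree `j`. As in
the convention `⟨★ a, b⟩ = (a ∪ b̄)[M]`, it is linear in the first argument and antilinear in the
second one. -/
structure CochainInnerProduct (K : AbstractSimplicialComplex V) where
  /-- the inner product `⟨a, b⟩` of cochains of degree `j` -/
  form : ∀ j : ℕ, Cochain K j →ₗ[ℂ] AntiDual (Cochain K j)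
  conj_symm : ∀ j a b, conj (form j b a) = form j a b
  pos : ∀ j a, a ≠ 0 → 0 < (form j a a).re

namespace CochainInnerProduct

variable {K : AbstractSimplicialComplex V} (ip : CochainInnerProduct K)

/-- The inner product on `1`-cochains is compatible with complex conjugation, `⟨ā, b̄⟩ = conj ⟨a, b⟩`:
it is the hermitian extension of a real inner product on the real `1`-cochains. -/
def IsReal : Prop := ∀ a b : Cochain K 1, ip.form 1 (star a) (star b) = conj (ip.form 1 a b)

/-- The isomorphism `a ↦ ⟨a, ·⟩`. -/
def riesz (j : ℕ) : Cochain K j ≃ₗ[ℂ] AntiDual (Cochain K j) :=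
  LinearEquiv.ofBijective (ip.form j) (riesz_bijective _ (ip.conj_symm j) (ip.pos j))

theorem form_riesz_symm (j : ℕ) (ψ : AntiDual (Cochain K j)) (b : Cochain K j) :
    ip.form j ((ip.riesz j).symm ψ) b = ψ b :=
  congrArg (fun f : AntiDual (Cochain K j) => f b) ((ip.riesz j).apply_symm_apply ψ)

/-- The adjoint `δ* : C^{j+1} → C^j` of the coboundary. -/
def codifferential (j : ℕ) : Cochain K (j + 1) →ₗ[ℂ] Cochain K j :=
  (ip.riesz j).symm.toLinearMap ∘ₗ
    { toFun := fun a => (ip.form (j + 1) a).comp (coboundary K j)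
      map_add' := fun a b => by ext; simp
      map_smul' := fun r a => by ext; simp }

/-- The defining property `⟨δ* a, b⟩ = ⟨a, δ b⟩`. -/
theorem form_codifferential (j : ℕ) (a : Cochain K (j + 1)) (b : Cochain K j) :
    ip.form j (ip.codifferential j a) b = ip.form (j + 1) a (coboundary K j b) :=
  ip.form_riesz_symm j _ b

/-- The combinatorial Laplacian `δ* δ + δ δ*` in degree `j + 1`. -/
def laplacian (j : ℕ) : Cochain K (j + 1) →ₗ[ℂ] Cochain K (j + 1) :=
  ip.codifferential (j + 1) ∘ₗ coboundary K (j + 1) + coboundary K j ∘ₗ ip.codifferential j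

/-- The space `H¹` of harmonic `1`-cochains. -/
def harmonic : Submodule ℂ (Cochain K 1) :=
  LinearMap.ker (ip.laplacian 0) ⊓ LinearMap.ker (coboundary K 1)
    ⊓ LinearMap.ker (ip.codifferential 0)

/-- The inner product restricted to the harmonic `1`-cochains. -/
def harmonicForm : ip.harmonic →ₗ[ℂ] AntiDual ip.harmonic where
  toFun a := (ip.form 1 (a : Cochain K 1)).comp ip.harmonic.subtype
  map_add' a b := by ext; simp
  map_smul' r a := by ext; simp

theorem harmonicForm_bijective : Function.Bijective ip.harmonicForm :=
  riesz_bijective _ (fun a b => ip.conj_symm 1 a b)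
    (fun a ha => ip.pos 1 a (fun h => ha (Subtype.ext h)))

/-- The orthogonal projection of the `1`-cochains onto the harmonic `1`-cochains. -/
def harmonicProjection : Cochain K 1 →ₗ[ℂ] ip.harmonic :=
  (LinearEquiv.ofBijective ip.harmonicForm ip.harmonicForm_bijective).symm.toLinearMap ∘ₗ
    { toFun := fun a => (ip.form 1 a).comp ip.harmonic.subtype
      map_add' := fun a b => by ext; simp
      map_smul' := fun r a => by ext; simp }

/-- The defining property of the orthogonal projection. -/
theorem form_harmonicProjection (a : Cochain K 1) (b : ip.harmonic) :
    ip.form 1 (ip.harmonicProjection a : Cochain K 1) (b : Cochain K 1) = ip.form 1 a b :=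
  congrArg (fun f : AntiDual ip.harmonic => f b)
    ((LinearEquiv.ofBijective ip.harmonicForm ip.harmonicForm_bijective).apply_symm_apply
      ((ip.form 1 a).comp ip.harmonic.subtype))

end CochainInnerProduct

/-! ### The combinatorial star operator and holomorphic cochains -/

section Star

variable (S : TriangulatedSurface V) (ip : CochainInnerProduct S.K)

/-- The combinatorial star operator on `1`-cochains, `⟨★ a, b⟩ = (a ∪ b̄)[M]`. -/
def combinatorialStar : Cochain S.K 1 →ₗ[ℂ] Cochain S.K 1 :=
  (ip.riesz 1).symm.toLinearMap ∘ₗ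
    { toFun := fun a =>
        { toFun := fun b => (cup a (star b)).eval S.fundamentalCycle
          map_add' := fun b b' => by rw [star_add, cup_add_right, Cochain.eval_add]
          map_smul' := fun r b => by
            rw [star_smul, cup_smul_right, Cochain.eval_smul]; rfl }
      map_add' := fun a a' => by
        ext b
        simp [cup_add_left, Cochain.eval_add]
      map_smul' := fun r a => by
        ext b
        simp [cup_smul_left, Cochain.eval_smul] }

/-- The defining property of the combinatorial star operator. -/
theorem form_combinatorialStar (a b : Cochain S.K 1) :
    ip.form 1 (combinatorialStar S ip a) b = (cup a (star b)).eval S.fundamentalCycle :=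
  ip.form_riesz_symm 1 _ b

/-- The operator induced by `★` on the harmonic `1`-cochains: `★` followed by the orthogonal
projection. (On the cochain level `★` need not preserve harmonic cochains.) -/
def harmonicStar : ip.harmonic →ₗ[ℂ] ip.harmonic :=
  ip.harmonicProjection ∘ₗ combinatorialStar S ip ∘ₗ ip.harmonic.subtype

/-- The space of holomorphic `1`-cochains, spanned by the harmonic `σ` with `★ σ = -i λ σ` for some
real `λ ≥ 0`, where `★` is the induced operator on harmonic cochains. -/
def holomorphicCochains : Submodule ℂ (Cochain S.K 1) :=
  Submodule.span ℂ {σ | ∃ (h : σ ∈ ip.harmonic) (l : ℝ), 0 ≤ l ∧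
    (harmonicStar S ip ⟨σ, h⟩ : Cochain S.K 1) = (-(Complex.I * l)) • σ}

/-! ### Canonical homology bases and periods -/

/-- The classes of the chains `c k` form a basis of the homology group `H₁(K; ℤ)`: they are cycles,
and every cycle is homologous to exactly one integral linear combination of them. -/
def IsHomologyBasis (K : AbstractSimplicialComplex V) {ι : Type*} [Fintype ι]
    (c : ι → Chain K 1) : Prop :=
  (∀ k, boundary K 0 (c k) = 0) ∧
    ∀ z : Chain K 1, boundary K 0 z = 0 →
      ∃! n : ι → ℤ, ∃ d : Chain K 2, z - ∑ k, n k • c k = boundary K 1 d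

/-- The closed `1`-cochain `η` is Poincaré dual to the `1`-cycle `c`: `α(c) = (α ∪ η)[M]` for every
closed `1`-cochain `α`. (Such an `η` exists for every cycle, and it is unique up to coboundaries.) -/
def IsPoincareDual (η : Cochain S.K 1) (c : Chain S.K 1) : Prop :=
  coboundary S.K 1 η = 0 ∧
    ∀ α : Cochain S.K 1, coboundary S.K 1 α = 0 →
      α.eval c = (cup α η).eval S.fundamentalCycle

/-- The `1`-cycles `c`, `c'` have algebraic intersection number `c · c' = n`, computed as
`(η_c ∪ η_{c'})[M]` from Poincaré duals of `c` and `c'`. -/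
def HasIntersectionNumber (c c' : Chain S.K 1) (n : ℤ) : Prop :=
  ∀ η η' : Cochain S.K 1, IsPoincareDual S η c → IsPoincareDual S η' c' →
    (cup η η').eval S.fundamentalCycle = n

/-- A canonical homology basis `a₁, …, a_g, b₁, …, b_g`, represented by simplicial cycles: a basis
of `H₁(K; ℤ)` with `aᵢ · bⱼ = δᵢⱼ` and `aᵢ · aⱼ = bᵢ · bⱼ = 0`. -/
structure IsCanonicalHomologyBasis {g : ℕ} (a b : Fin g → Chain S.K 1) : Prop where
  isHomologyBasis : IsHomologyBasis S.K (Sum.elim a b)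
  inter_ab : ∀ i j, HasIntersectionNumber S (a i) (b j) (if i = j then 1 else 0)
  inter_aa : ∀ i j, HasIntersectionNumber S (a i) (a j) 0
  inter_bb : ∀ i j, HasIntersectionNumber S (b i) (b j) 0

/-- The canonical basis of the holomorphic `1`-cochains: a basis with `σᵢ(aⱼ) = δᵢⱼ`. -/
structure IsCanonicalHolomorphicBasis {g : ℕ} (a : Fin g → Chain S.K 1)
    (σ : Fin g → Cochain S.K 1) : Prop where
  linearIndependent : LinearIndependent ℂ σ
  span_eq : Submodule.span ℂ (Set.range σ) = holomorphicCochains S ip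
  aPeriods : ∀ i j, (σ i).eval (a j) = if i = j then 1 else 0

/-- The matrix of `B`-periods `πᵢⱼ = σᵢ(bⱼ)`. -/
def periodMatrix {K : AbstractSimplicialComplex V} {g : ℕ} (b : Fin g → Chain K 1)
    (σ : Fin g → Cochain K 1) : Matrix (Fin g) (Fin g) ℂ :=
  Matrix.of fun i j => (σ i).eval (b j)

end Star

end Surface

end

/-!
The operator `i★` is self-adjoint on harmonic `1`-cochains, because `⟨i★σ, τ⟩ = i(σ ∪ τ̄)[M]`
and `∪` is skew and commutes with conjugation. It is also injective, by Poincaré duality. The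
holomorphic cochains are the span of its eigenvectors with nonnegative eigenvalue; complex
conjugation exchanges positive and negative eigenvectors, so `(σ ∪ τ)[M] = 0` for holomorphic `σ`
and `τ`, whereas `i(σ ∪ σ̄)[M] > 0` for `σ ≠ 0`. Riemann's bilinear relation
`(α ∪ β)[M] = ∑ₖ (α(aₖ) β(bₖ) - α(bₖ) β(aₖ))` for closed `α` and `β` translates the vanishing into
the symmetry of `Π` and the positivity into the injectivity of the `A`-period map and `Im Π > 0`.
Surjectivity: if `φ` annihilates all `A`-periods, the harmonic `τ` with periods `τ(aₖ) = 0` and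
`τ(bₖ) = φₖ` pairs to zero with every holomorphic cochain, so `τ` is itself holomorphic, and it
vanishes since its `A`-periods do.

A Poincaré dual of a cycle `c` is glued from local primitives. As the link of a vertex `p` is
connected, the closed `1`-cochains supported on the star of `p` are the multiples of the coboundary
of the indicator of `p`, and these vanish on `c`. By linear duality there are values `d p t` on the
triangles `t` whose chain has boundary `-c` near `p`. On every edge the difference of the values
chosen at its two ends is the same for both adjacent triangles, as these have opposite orientations
in `[M]`, and the differences form the dual cochain.
-/

section SelfAdjoint

variable {E : Type*} [AddCommGroup E] [Module ℂ E] {B : E →ₗ[ℂ] AntiDual E} {T : Module.End ℂ E}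

/-- The span of the eigenvectors of `T` with nonnegative real eigenvalue. -/
noncomputable def nonnegEigenspan (T : Module.End ℂ E) : Submodule ℂ E :=
  ⨆ l : NNReal, T.eigenspace ((l : ℝ) : ℂ)

theorem map_mem_nonnegEigenspan {C : E →ₗ⋆[ℂ] E} {T' : Module.End ℂ E}
    (hC : ∀ x, T' (C x) = C (T x)) {x : E} (hx : x ∈ nonnegEigenspan T) :
    C x ∈ nonnegEigenspan T' := by
  induction hx using Submodule.iSup_induction' with
  | zero => simp
  | add x₁ x₂ _ _ h₁ h₂ => simpa using add_mem h₁ h₂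
  | mem l x hx =>
    refine Submodule.mem_iSup_of_mem l (Module.End.mem_eigenspace_iff.2 ?_)
    rw [hC, Module.End.mem_eigenspace_iff.1 hx, map_smulₛₗ, Complex.conj_ofReal]

theorem form_eq_zero_of_mem_eigenspace (hT : ∀ x y, B (T x) y = B x (T y)) {l m : ℝ} (hlm : l ≠ m)
    {x y : E} (hx : x ∈ T.eigenspace (l : ℂ)) (hy : y ∈ T.eigenspace (m : ℂ)) : B x y = 0 := by
  have h : (l : ℂ) * B x y = m * B x y := by
    have hTxy := hT x y
    rwa [Module.End.mem_eigenspace_iff.1 hx, Module.End.mem_eigenspace_iff.1 hy, map_smul,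
      LinearMap.smul_apply, map_smulₛₗ, Complex.conj_ofReal] at hTxy
  exact (mul_eq_mul_right_iff.1 h).resolve_left (Complex.ofReal_injective.ne hlm)

theorem form_apply_eq_zero_of_mem_nonnegEigenspan_neg (hT : ∀ x y, B (T x) y = B x (T y)) {x y : E}
    (hx : x ∈ nonnegEigenspan T) (hy : y ∈ nonnegEigenspan (-T)) : B (T x) y = 0 := by
  induction hx using Submodule.iSup_induction' with
  | zero => simp
  | add x₁ x₂ _ _ h₁ h₂ => simp [h₁, h₂]
  | mem l x hx =>
    induction hy using Submodule.iSup_induction' with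
    | zero => simp
    | add y₁ y₂ _ _ h₁ h₂ => simp [h₁, h₂]
    | mem m y hy =>
      have hTy : y ∈ T.eigenspace ((-m : ℝ) : ℂ) := by
        rw [Module.End.mem_eigenspace_iff, Complex.ofReal_neg, neg_smul,
          ← Module.End.mem_eigenspace_iff.1 hy, LinearMap.neg_apply, neg_neg]
      rw [Module.End.mem_eigenspace_iff.1 hx, map_smul, LinearMap.smul_apply, smul_eq_mul]
      obtain hl | hl := eq_or_ne l 0
      · simp [hl]
      · have hlm : (l : ℝ) ≠ -m := by
          have := NNReal.coe_pos.2 (pos_iff_ne_zero.2 hl)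
          linarith [m.coe_nonneg]
        rw [form_eq_zero_of_mem_eigenspace hT hlm hx hTy, mul_zero]

theorem re_form_apply_pos_of_mem_nonnegEigenspan (hpos : ∀ x, x ≠ 0 → 0 < (B x x).re)
    (hT : ∀ x y, B (T x) y = B x (T y)) (hinj : Function.Injective T) {x : E}
    (hx : x ∈ nonnegEigenspan T) (hx0 : x ≠ 0) : 0 < (B (T x) x).re := by
  obtain ⟨f, hf, rfl⟩ := (Submodule.mem_iSup_iff_exists_finsupp _ _).1 hx
  have hoff : ∀ l m, m ≠ l → B (f l) (f m) = 0 := fun l m hml =>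
    form_eq_zero_of_mem_eigenspace hT (NNReal.coe_injective.ne hml.symm) (hf l) (hf m)
  have hsum : B (T (f.sum fun _ y => y)) (f.sum fun _ y => y) =
      ∑ l ∈ f.support, ((l : ℝ) : ℂ) * B (f l) (f l) := by
    have hmul : ∀ l m, B (T (f l)) (f m) = ((l : ℝ) : ℂ) * B (f l) (f m) := fun l m => by
      rw [Module.End.mem_eigenspace_iff.1 (hf l), map_smul, LinearMap.smul_apply, smul_eq_mul]
    simp only [Finsupp.sum, map_sum, LinearMap.sum_apply, hmul]
    refine Finset.sum_congr rfl fun l hl => Finset.sum_eq_single_of_mem l hl fun m _ hml => ?_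
    rw [hoff m l hml.symm, mul_zero]
  rw [hsum, Complex.re_sum]
  have hne : f.support.Nonempty := by
    rw [Finset.nonempty_iff_ne_empty]
    intro h
    simp [Finsupp.sum, h] at hx0
  refine Finset.sum_pos (fun l hl => ?_) hne
  have hfl : f l ≠ 0 := Finsupp.mem_support_iff.1 hl
  have hl0 : l ≠ 0 := by
    rintro rfl
    refine hfl (hinj ?_)
    simpa using Module.End.mem_eigenspace_iff.1 (hf 0)
  rw [Complex.re_ofReal_mul]
  exact mul_pos (NNReal.coe_pos.2 (pos_iff_ne_zero.2 hl0)) (hpos _ hfl)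

theorem iSup_eigenspace_ofReal_eq_top [FiniteDimensional ℂ E]
    (hsymm : ∀ x y, conj (B y x) = B x y) (hpos : ∀ x, x ≠ 0 → 0 < (B x x).re)
    (hT : ∀ x y, B (T x) y = B x (T y)) : ⨆ l : ℝ, T.eigenspace (l : ℂ) = ⊤ := by
  let core : InnerProductSpace.Core ℂ E :=
    { inner := fun x y => B y x
      conj_inner_symm := fun x y => hsymm y x
      re_inner_nonneg := fun x => by
        obtain rfl | hx := eq_or_ne x 0
        · simp
        · exact (hpos x hx).le
      add_left := fun x y z => by simp
      smul_left := fun x y r => by simp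
      definite := fun x hx => by
        by_contra hne
        simpa [show B x x = 0 from hx] using hpos x hne }
  let _ : NormedAddCommGroup E := core.toNormedAddCommGroup
  let _ : InnerProductSpace ℂ E := InnerProductSpace.ofCore core.toCore
  have hTs : T.IsSymmetric := fun x y => (hT y x).symm
  rw [eq_top_iff, ← (hTs.eigenvectorBasis rfl).toBasis.span_eq, Submodule.span_le]
  rintro _ ⟨i, rfl⟩
  refine Submodule.mem_iSup_of_mem (hTs.eigenvalues rfl i) (Module.End.mem_eigenspace_iff.2 ?_)
  simp

theorem nonnegEigenspan_sup_nonnegEigenspan_neg [FiniteDimensional ℂ E]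
    (hsymm : ∀ x y, conj (B y x) = B x y) (hpos : ∀ x, x ≠ 0 → 0 < (B x x).re)
    (hT : ∀ x y, B (T x) y = B x (T y)) : nonnegEigenspan T ⊔ nonnegEigenspan (-T) = ⊤ := by
  rw [eq_top_iff, ← iSup_eigenspace_ofReal_eq_top hsymm hpos hT, iSup_le_iff]
  intro l
  obtain hl | hl := le_total 0 l
  · lift l to NNReal using hl
    exact le_sup_of_le_left (le_iSup (fun m : NNReal => T.eigenspace ((m : ℝ) : ℂ)) l)
  · obtain ⟨m, rfl⟩ : ∃ m : NNReal, l = -m :=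
      ⟨(-l).toNNReal, by rw [Real.coe_toNNReal _ (neg_nonneg.2 hl), neg_neg]⟩
    refine le_sup_of_le_right (le_trans (fun x hx => ?_)
      (le_iSup (fun m : NNReal => (-T).eigenspace ((m : ℝ) : ℂ)) m))
    rw [Module.End.mem_eigenspace_iff, LinearMap.neg_apply, Module.End.mem_eigenspace_iff.1 hx,
      Complex.ofReal_neg, neg_smul, neg_neg]

end SelfAdjoint

section Fredholm

variable {𝕜 M ι : Type*} [Field 𝕜] [AddCommGroup M] [Module 𝕜 M] [Fintype ι]

theorem exists_eqOn_of_forall_dotProduct_eq_zero (A : M →ₗ[𝕜] ι → 𝕜) (y : ι → 𝕜) (s : Set ι)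
    (h : ∀ φ : ι → 𝕜, (∀ i ∉ s, φ i = 0) → (∀ x, φ ⬝ᵥ A x = 0) → φ ⬝ᵥ y = 0) :
    ∃ x, Set.EqOn (A x) y s := by
  classical
  let restrict : (ι → 𝕜) →ₗ[𝕜] ι → 𝕜 := LinearMap.mulLeft 𝕜 (s.indicator 1)
  have hadj : ∀ φ z : ι → 𝕜, φ ⬝ᵥ restrict z = restrict φ ⬝ᵥ z := fun φ z =>
    Finset.sum_congr rfl fun i _ => by
      rw [LinearMap.mulLeft_apply, LinearMap.mulLeft_apply, Pi.mul_apply, Pi.mul_apply,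
        mul_left_comm, mul_assoc]
  suffices hmem : restrict y ∈ LinearMap.range (restrict ∘ₗ A) by
    obtain ⟨x, hx⟩ := hmem
    refine ⟨x, fun i hi => ?_⟩
    simpa [restrict, hi] using congrFun hx i
  by_contra hy
  obtain ⟨f, hfy, hf⟩ := Submodule.exists_le_ker_of_notMem hy
  obtain ⟨φ, rfl⟩ := (dotProductEquiv 𝕜 ι).surjective f
  refine hfy ((hadj φ y).trans (h _ (fun i hi => by simp [restrict, hi]) fun x => ?_))
  rw [← hadj]
  exact hf ⟨x, rfl⟩

end Fredholm

section Simplices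

variable {V : Type*} {K : AbstractSimplicialComplex V} {j : ℕ}

namespace Simplex

/-- The vertex `v` as a simplex of dimension zero. -/
def point (K : AbstractSimplicialComplex V) (v : V) : Simplex K 0 :=
  ⟨{v}, K.singleton_mem v, rfl⟩

theorem exists_eq_point (p : Simplex K 0) : ∃ v, p = point K v := by
  obtain ⟨v, hv⟩ := Finset.card_eq_one.1 p.2.2
  exact ⟨v, Subtype.ext hv⟩

variable [LinearOrder V]

/-- The `i`-th vertex of a simplex, in increasing order. -/
def vertex (s : Simplex K j) (i : Fin (j + 1)) : V :=
  s.1.orderEmbOfFin s.2.2 i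

theorem vertex_injective (s : Simplex K j) : Function.Injective s.vertex :=
  (s.1.orderEmbOfFin s.2.2).injective

theorem mem_iff_exists_vertex_eq {s : Simplex K j} {v : V} : v ∈ s.1 ↔ ∃ i, s.vertex i = v := by
  rw [← Finset.mem_coe, ← Finset.range_orderEmbOfFin s.1 s.2.2]
  rfl

theorem ext_vertex {s t : Simplex K j} (h : ∀ i, s.vertex i = t.vertex i) : s = t :=
  Subtype.ext (Finset.ext fun v => by simp only [mem_iff_exists_vertex_eq, h])

theorem face_subset (s : Simplex K (j + 1)) (i : Fin (j + 2)) : (s.face i).1 ⊆ s.1 :=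
  Finset.erase_subset _ _

theorem vertex_notMem_face (s : Simplex K (j + 1)) (i : Fin (j + 2)) :
    s.vertex i ∉ (s.face i).1 :=
  Finset.notMem_erase _ _

theorem vertex_mem (s : Simplex K j) (i : Fin (j + 1)) : s.vertex i ∈ s.1 :=
  s.1.orderEmbOfFin_mem s.2.2 i

theorem face_injective (s : Simplex K (j + 1)) : Function.Injective s.face := fun i k h =>
  s.vertex_injective (s.1.erase_injOn (s.vertex_mem i) (s.vertex_mem k) (congrArg Subtype.val h))

theorem vertex_face (s : Simplex K (j + 1)) (i : Fin (j + 2)) (k : Fin (j + 1)) :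
    (s.face i).vertex k = s.vertex (i.succAbove k) := by
  have hmem : ∀ k, s.vertex (i.succAbove k) ∈ (s.face i).1 := fun k =>
    Finset.mem_erase.2 ⟨s.vertex_injective.ne (i.succAbove_ne k), s.vertex_mem _⟩
  have hmono : StrictMono fun k => s.vertex (i.succAbove k) :=
    (s.1.orderEmbOfFin s.2.2).strictMono.comp i.strictMono_succAbove
  exact (congrFun (Finset.orderEmbOfFin_unique (s.face i).2.2 hmem hmono) k).symm

theorem face_face_succAbove_predAbove (s : Simplex K (j + 2)) (i : Fin (j + 3)) (k : Fin (j + 2)) :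
    (s.face (i.succAbove k)).face (k.predAbove i) = (s.face i).face k :=
  ext_vertex fun l => by
    simp only [vertex_face, Fin.succAbove_succAbove_succAbove_predAbove]

theorem exists_face_eq {s : Simplex K (j + 1)} {r : Simplex K j} (h : r.1 ⊆ s.1) :
    ∃ i, s.face i = r := by
  obtain ⟨v, hvr, hv⟩ := Finset.exists_eq_insert_iff.2 ⟨h, by rw [r.2.2, s.2.2]⟩
  obtain ⟨i, rfl⟩ := mem_iff_exists_vertex_eq.1 (hv ▸ Finset.mem_insert_self v r.1)
  refine ⟨i, Subtype.ext ?_⟩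
  change s.1.erase (s.vertex i) = r.1
  rw [← hv, Finset.erase_insert hvr]

theorem exists_not_subset_face (r : Simplex K 0) (s : Simplex K (j + 1)) :
    ∃ i, ¬r.1 ⊆ (s.face i).1 := by
  by_cases h : r.vertex 0 ∈ s.1
  · obtain ⟨i, hi⟩ := mem_iff_exists_vertex_eq.1 h
    exact ⟨i, fun hr => s.vertex_notMem_face i (hi ▸ hr (r.vertex_mem 0))⟩
  · exact ⟨0, fun hr => h (s.face_subset 0 (hr (r.vertex_mem 0)))⟩

/-- The edge joining two adjacent vertices. -/
def edge (v w : V) (h : v ≠ w ∧ {v, w} ∈ K.faces) : Simplex K 1 :=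
  ⟨{v, w}, h.2, Finset.card_pair h.1⟩

end Simplex

end Simplices

section Coboundary

variable {V : Type*} [LinearOrder V] {K : AbstractSimplicialComplex V} {j : ℕ}

theorem coboundary_apply (f : Cochain K j) (s : Simplex K (j + 1)) :
    coboundary K j f s = ∑ i : Fin (j + 2), (-1 : ℂ) ^ (i : ℕ) * f (s.face i) :=
  rfl

theorem coboundary_single_face (s : Simplex K (j + 1)) (i : Fin (j + 2)) :
    coboundary K j (Pi.single (s.face i) 1) s = (-1) ^ (i : ℕ) := by
  simp only [coboundary_apply, Pi.single_apply, s.face_injective.eq_iff, mul_ite, mul_one, mul_zero,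
    Finset.sum_ite_eq', Finset.mem_univ, if_true]

theorem coboundary_single_of_not_subset {r : Simplex K j} {s : Simplex K (j + 1)}
    (h : ¬r.1 ⊆ s.1) : coboundary K j (Pi.single r 1) s = 0 := by
  rw [coboundary_apply]
  refine Finset.sum_eq_zero fun i _ => ?_
  rw [Pi.single_eq_of_ne, mul_zero]
  rintro rfl
  exact h (s.face_subset i)

theorem coboundary_single_mul_self {r : Simplex K j} {s : Simplex K (j + 1)} (h : r.1 ⊆ s.1) :
    coboundary K j (Pi.single r 1) s * coboundary K j (Pi.single r 1) s = 1 := by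
  obtain ⟨i, rfl⟩ := Simplex.exists_face_eq h
  rw [coboundary_single_face, ← mul_pow, neg_mul_neg, one_mul, one_pow]

theorem coboundary_star (f : Cochain K j) : coboundary K j (star f) = star (coboundary K j f) := by
  funext s
  simp [coboundary_apply]

theorem coboundary_coboundary (f : Cochain K j) :
    coboundary K (j + 1) (coboundary K j f) = 0 := by
  funext s
  simp only [coboundary_apply, Pi.zero_apply, Finset.mul_sum, ← mul_assoc, ← pow_add]
  rw [← Fintype.sum_prod_type' fun (i : Fin (j + 3)) (k : Fin (j + 2)) =>
    (-1 : ℂ) ^ ((i : ℕ) + k) * f ((s.face i).face k)]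
  refine Finset.sum_involution (fun p _ => (p.1.succAbove p.2, p.2.predAbove p.1))
    (fun p _ => ?_) (fun p _ _ h => Fin.succAbove_ne _ _ (congrArg Prod.fst h))
    (fun p _ => Finset.mem_univ _) (fun p _ => ?_)
  · rw [s.face_face_succAbove_predAbove, Fin.neg_one_pow_succAbove_add_predAbove]
    ring
  · rw [Fin.succAbove_succAbove_predAbove, Fin.predAbove_predAbove_succAbove]

theorem coboundary_edge_apply (f : Cochain K 0) (e : Simplex K 1) :
    coboundary K 0 f e = f (e.face 0) - f (e.face 1) := by
  simp [coboundary_apply, sub_eq_add_neg]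

theorem coboundary_triangle_apply (f : Cochain K 1) (t : Simplex K 2) :
    coboundary K 1 f t = f (t.face 0) - f (t.face 1) + f (t.face 2) := by
  simp [coboundary_apply, Fin.sum_univ_three, sub_eq_add_neg]

theorem apply_mul_apply_comm_of_coboundary_eq_zero {φ ψ : Cochain K 1} {t : Simplex K 2}
    (hφ : coboundary K 1 φ t = 0) (hψ : coboundary K 1 ψ t = 0) {i : Fin 3}
    (hφi : φ (t.face i) = 0) (hψi : ψ (t.face i) = 0) (k l : Fin 3) :
    φ (t.face k) * ψ (t.face l) = φ (t.face l) * ψ (t.face k) := by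
  rw [coboundary_triangle_apply] at hφ hψ
  fin_cases i <;> fin_cases k <;> fin_cases l <;> grind

end Coboundary

section Evaluation

variable {V : Type*} [Fintype V] {K : AbstractSimplicialComplex V} {j : ℕ}

namespace Cochain

theorem eval_sub (f g : Cochain K j) (c : Chain K j) : (f - g).eval c = f.eval c - g.eval c := by
  simp [eval, mul_sub, Finset.sum_sub_distrib]

theorem eval_sum {ι : Type*} (s : Finset ι) (f : ι → Cochain K j) (c : Chain K j) :
    (∑ k ∈ s, f k).eval c = ∑ k ∈ s, (f k).eval c := by
  simp only [eval, Finset.sum_apply, Finset.mul_sum]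
  exact Finset.sum_comm

theorem eval_star (f : Cochain K j) (c : Chain K j) : eval (star f) c = conj (f.eval c) := by
  simp [eval]

theorem eval_sub_right (f : Cochain K j) (c d : Chain K j) :
    f.eval (c - d) = f.eval c - f.eval d := by
  simp [eval, sub_mul, Finset.sum_sub_distrib]

theorem eval_sum_zsmul_right {ι : Type*} (f : Cochain K j) (s : Finset ι) (n : ι → ℤ)
    (c : ι → Chain K j) : f.eval (∑ k ∈ s, n k • c k) = ∑ k ∈ s, n k * f.eval (c k) := by
  simp only [eval, Finset.sum_apply, Pi.smul_apply, smul_eq_mul, Int.cast_sum, Int.cast_mul,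
    Finset.sum_mul, Finset.mul_sum, mul_assoc]
  exact Finset.sum_comm

theorem eval_single (f : Cochain K j) (s : Simplex K j) : f.eval (Pi.single s 1) = f s := by
  simp [eval, Pi.single_apply]

theorem single_eval (s : Simplex K j) (c : Chain K j) : eval (Pi.single s 1) c = c s := by
  simp [eval, Pi.single_apply]

end Cochain

theorem Chain.eq_of_forall_eval_eq {c d : Chain K j} (h : ∀ f : Cochain K j, f.eval c = f.eval d) :
    c = d :=
  funext fun s => by simpa only [Cochain.single_eval, Int.cast_inj] using h (Pi.single s 1)

end Evaluation

section Stokes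

variable {V : Type*} [Fintype V] [LinearOrder V] {K : AbstractSimplicialComplex V}

theorem Cochain.eval_coboundary {j : ℕ} (f : Cochain K j) (c : Chain K (j + 1)) :
    (coboundary K j f).eval c = f.eval (boundary K j c) := by
  simp only [Cochain.eval, coboundary_apply, boundary, LinearMap.coe_mk, AddHom.coe_mk,
    Int.cast_sum, Finset.sum_mul, Finset.mul_sum]
  refine (Finset.sum_congr rfl fun t _ => ?_).trans Finset.sum_comm
  refine (Finset.sum_congr rfl fun i _ => ?_).trans Finset.sum_comm
  simp only [Int.cast_ite, Int.cast_mul, Int.cast_pow, Int.cast_neg, Int.cast_one, Int.cast_zero,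
    ite_mul, zero_mul, Finset.sum_ite_eq, Finset.mem_univ, if_true]
  ring

theorem Cochain.eval_coboundary_of_boundary_eq_zero {j : ℕ} (f : Cochain K j)
    {c : Chain K (j + 1)} (hc : boundary K j c = 0) : (coboundary K j f).eval c = 0 := by
  rw [eval_coboundary, hc]
  simp [eval]

theorem boundary_single_edge (e : Simplex K 1) :
    boundary K 0 (Pi.single e 1) = Pi.single (e.face 0) 1 - Pi.single (e.face 1) 1 :=
  Chain.eq_of_forall_eval_eq fun f => by
    rw [← Cochain.eval_coboundary, Cochain.eval_single, Cochain.eval_sub_right,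
      Cochain.eval_single, Cochain.eval_single, coboundary_edge_apply]

theorem exists_boundary_eq_of_adj {u v : V} (h : (oneSkeleton K).Adj u v) :
    ∃ c : Chain K 1, boundary K 0 c =
      Pi.single (Simplex.point K v) 1 - Pi.single (Simplex.point K u) 1 := by
  let e := Simplex.edge u v h
  have hue : (Simplex.point K u).1 ⊆ e.1 := by simp [e, Simplex.point, Simplex.edge]
  have hve : (Simplex.point K v).1 ⊆ e.1 := by simp [e, Simplex.point, Simplex.edge]
  obtain ⟨i, hi⟩ := Simplex.exists_face_eq hue
  obtain ⟨k, hk⟩ := Simplex.exists_face_eq hve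
  have hik : i ≠ k := by
    rintro rfl
    exact h.1 (Finset.singleton_injective (congrArg Subtype.val (hi.symm.trans hk)))
  rw [← hi, ← hk]
  have hcases : ∀ i k : Fin 2, i ≠ k → i = 0 ∧ k = 1 ∨ i = 1 ∧ k = 0 := by decide
  obtain ⟨rfl, rfl⟩ | ⟨rfl, rfl⟩ := hcases i k hik
  · exact ⟨-Pi.single e 1, by rw [map_neg, boundary_single_edge, neg_sub]⟩
  · exact ⟨Pi.single e 1, boundary_single_edge e⟩

theorem exists_boundary_eq_of_connected (hconn : (oneSkeleton K).Connected) (u v : V) :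
    ∃ c : Chain K 1, boundary K 0 c =
      Pi.single (Simplex.point K v) 1 - Pi.single (Simplex.point K u) 1 := by
  obtain ⟨p⟩ := hconn.preconnected u v
  induction p with
  | nil => exact ⟨0, by simp⟩
  | cons huv _ ih =>
    obtain ⟨c, hc⟩ := ih
    obtain ⟨d, hd⟩ := exists_boundary_eq_of_adj huv
    exact ⟨c + d, by rw [map_add, hc, hd, sub_add_sub_cancel]⟩

theorem exists_eq_coboundary_of_eval_eq_zero (hconn : (oneSkeleton K).Connected)
    {α : Cochain K 1} (h : ∀ z : Chain K 1, boundary K 0 z = 0 → α.eval z = 0) :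
    ∃ f : Cochain K 0, α = coboundary K 0 f := by
  obtain ⟨u⟩ := hconn.nonempty
  have hpath : ∀ p : Simplex K 0, ∃ c : Chain K 1, boundary K 0 c =
      Pi.single p 1 - Pi.single (Simplex.point K u) 1 := fun p => by
    obtain ⟨v, rfl⟩ := p.exists_eq_point
    exact exists_boundary_eq_of_connected hconn u v
  choose c hc using hpath
  refine ⟨fun p => α.eval (c p), funext fun e => ?_⟩
  have hloop : boundary K 0 (c (e.face 0) - c (e.face 1) - Pi.single e 1) = 0 := by
    rw [map_sub, map_sub, hc, hc, boundary_single_edge]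
    abel
  have hα := h _ hloop
  rw [Cochain.eval_sub_right, Cochain.eval_sub_right, Cochain.eval_single] at hα
  rw [coboundary_edge_apply]
  exact (sub_eq_zero.1 hα).symm

end Stokes

section Edges

variable {V : Type*} [LinearOrder V] {K : AbstractSimplicialComplex V}

theorem Simplex.exists_eq_edge {e : Simplex K 1} {v : V} (hv : v ∈ e.1) :
    ∃ (w : V) (h : v ≠ w ∧ {v, w} ∈ K.faces), e = Simplex.edge v w h := by
  obtain ⟨w, hw⟩ := Finset.card_eq_one.1 ((Finset.card_erase_of_mem hv).trans (by rw [e.2.2]))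
  have he : e.1 = {v, w} := by rw [← hw, Finset.insert_erase hv]
  have hvw : v ≠ w := fun h => Finset.notMem_erase v e.1 (by rw [hw, h, Finset.mem_singleton])
  exact ⟨w, ⟨hvw, he ▸ e.2.1⟩, Subtype.ext he⟩

theorem mul_coboundary_single_eq_of_subset {φ : Cochain K 1} (hφ : coboundary K 1 φ = 0)
    {p : Simplex K 0} (hp : ∀ e : Simplex K 1, ¬p.1 ⊆ e.1 → φ e = 0) {e e' : Simplex K 1}
    {t : Simplex K 2} (het : e.1 ⊆ t.1) (het' : e'.1 ⊆ t.1) (hpe : p.1 ⊆ e.1) (hpe' : p.1 ⊆ e'.1) :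
    φ e * coboundary K 0 (Pi.single p 1) e = φ e' * coboundary K 0 (Pi.single p 1) e' := by
  obtain ⟨m, hm⟩ := p.exists_not_subset_face t
  obtain ⟨k, rfl⟩ := Simplex.exists_face_eq het
  obtain ⟨l, rfl⟩ := Simplex.exists_face_eq het'
  have hcomm := apply_mul_apply_comm_of_coboundary_eq_zero (congrFun hφ t)
    (congrFun (coboundary_coboundary (Pi.single p 1)) t) (hp _ hm)
    (coboundary_single_of_not_subset hm) k l
  have hk := coboundary_single_mul_self hpe
  have hl := coboundary_single_mul_self hpe'
  set β := coboundary K 0 (Pi.single p 1)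
  calc φ (t.face k) * β (t.face k)
      = φ (t.face k) * β (t.face l) * (β (t.face l) * β (t.face k)) := by
        rw [mul_assoc, ← mul_assoc (β (t.face l)), hl, one_mul]
    _ = φ (t.face l) * (β (t.face k) * β (t.face k)) * β (t.face l) := by rw [hcomm]; ring
    _ = φ (t.face l) * β (t.face l) := by rw [hk, mul_one]

end Edges

section CupPairing

variable {V : Type*} [Fintype V] [LinearOrder V]

theorem cup_apply_eq_coboundary {K : AbstractSimplicialComplex V} {α η : Cochain K 1}
    {t : Simplex K 2} (hα : coboundary K 1 α t = 0) (f : Cochain K 0)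
    (hη : ∀ i, η (t.face i) = coboundary K 0 f (t.face i)) :
    cup α η t = -(1 / 2) * coboundary K 1 (fun e => α e * (f (e.face 0) + f (e.face 1))) t := by
  have h₀ : (t.face 1).face 0 = (t.face 0).face 0 := t.face_face_succAbove_predAbove 0 0
  have h₁ : (t.face 2).face 0 = (t.face 0).face 1 := t.face_face_succAbove_predAbove 0 1
  have h₂ : (t.face 2).face 1 = (t.face 1).face 1 := t.face_face_succAbove_predAbove 1 1
  rw [coboundary_triangle_apply] at hα
  simp only [cup_apply, coboundary_triangle_apply, hη, coboundary_edge_apply, h₀, h₁, h₂]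
  have hα₁ : α (t.face 1) = α (t.face 0) + α (t.face 2) := by linear_combination -hα
  rw [hα₁]
  ring

variable (S : TriangulatedSurface V)

/-- The bilinear form `(α, β) ↦ (α ∪ β)[M]` on `1`-cochains. -/
noncomputable def cupPairing : LinearMap.BilinForm ℂ (Cochain S.K 1) :=
  LinearMap.mk₂ ℂ (fun α β => (cup α β).eval S.fundamentalCycle)
    (fun α α' β => by rw [cup_add_left, Cochain.eval_add])
    (fun r α β => by rw [cup_smul_left, Cochain.eval_smul, smul_eq_mul])
    (fun α β β' => by rw [cup_add_right, Cochain.eval_add])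
    (fun r α β => by rw [cup_smul_right, Cochain.eval_smul, smul_eq_mul])

theorem cupPairing_apply (α β : Cochain S.K 1) :
    cupPairing S α β = (cup α β).eval S.fundamentalCycle :=
  rfl

theorem cupPairing_swap (α β : Cochain S.K 1) : cupPairing S α β = -cupPairing S β α := by
  simp only [cupPairing_apply, Cochain.eval, ← Finset.sum_neg_distrib]
  refine Finset.sum_congr rfl fun t _ => ?_
  rw [cup_apply, cup_apply]
  ring

theorem cupPairing_star (α β : Cochain S.K 1) :
    cupPairing S (star α) (star β) = conj (cupPairing S α β) := by
  rw [cupPairing_apply, cupPairing_apply, ← Cochain.eval_star]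
  congr 1
  funext t
  simp [cup_apply]

theorem cupPairing_coboundary {α : Cochain S.K 1} (hα : coboundary S.K 1 α = 0)
    (f : Cochain S.K 0) : cupPairing S α (coboundary S.K 0 f) = 0 := by
  have hcup : cup α (coboundary S.K 0 f) = (-(1 / 2) : ℂ) •
      coboundary S.K 1 (fun e => α e * (f (e.face 0) + f (e.face 1))) :=
    funext fun t => cup_apply_eq_coboundary (congrFun hα t) f fun _ => rfl
  rw [cupPairing_apply, hcup, Cochain.eval_smul,
    Cochain.eval_coboundary_of_boundary_eq_zero _ S.boundary_fundamentalCycle, mul_zero]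

end CupPairing

section FundamentalBoundary

variable {V : Type*} [Fintype V] [LinearOrder V] (S : TriangulatedSurface V)

/-- The boundary of the complex `2`-chain `∑ t, x t • [M]_t • t`, where `[M]_t` is the coefficient
of the triangle `t` in the fundamental cycle. Its coefficient at an edge is computed dually, by
pairing with the coboundary of the indicator of that edge, which avoids choosing incidence signs. -/
noncomputable def fundamentalBoundary : Cochain S.K 2 →ₗ[ℂ] Cochain S.K 1 where
  toFun x e := (x * coboundary S.K 1 (Pi.single e 1)).eval S.fundamentalCycle
  map_add' x y := funext fun e => by rw [add_mul, Cochain.eval_add, Pi.add_apply]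
  map_smul' r x := funext fun e => by rw [smul_mul_assoc, Cochain.eval_smul]; rfl

theorem fundamentalBoundary_apply (x : Cochain S.K 2) (e : Simplex S.K 1) :
    fundamentalBoundary S x e =
      (x * coboundary S.K 1 (Pi.single e 1)).eval S.fundamentalCycle :=
  rfl

theorem fundamentalBoundary_const (r : ℂ) : fundamentalBoundary S (fun _ => r) = 0 := by
  funext e
  have hconst : (fun _ => r) * coboundary S.K 1 (Pi.single e 1) =
      r • coboundary S.K 1 (Pi.single e 1) := rfl
  rw [fundamentalBoundary_apply, hconst, Cochain.eval_smul,
    Cochain.eval_coboundary_of_boundary_eq_zero _ S.boundary_fundamentalCycle, mul_zero,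
    Pi.zero_apply]

theorem sum_fundamentalBoundary (x : Simplex S.K 1 → Cochain S.K 2) :
    ∑ e, fundamentalBoundary S (x e) e =
      Cochain.eval (fun t => coboundary S.K 1 (fun e => x e t) t) S.fundamentalCycle := by
  simp only [fundamentalBoundary_apply, ← Cochain.eval_sum]
  congr 1
  funext t
  have hsum : (fun e => x e t) = ∑ e, x e t • (Pi.single e 1 : Cochain S.K 1) := by
    simp_rw [← Pi.single_smul, smul_eq_mul, mul_one]
    exact (Finset.univ_sum_single _).symm
  rw [hsum, map_sum, Finset.sum_apply, Finset.sum_apply]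
  exact Finset.sum_congr rfl fun e _ => by rw [map_smul, Pi.smul_apply, smul_eq_mul, Pi.mul_apply]

theorem dotProduct_fundamentalBoundary (φ : Cochain S.K 1) (x : Cochain S.K 2) :
    φ ⬝ᵥ fundamentalBoundary S x = (x * coboundary S.K 1 φ).eval S.fundamentalCycle := by
  have h := sum_fundamentalBoundary S fun e => φ e • x
  simp only [map_smul, Pi.smul_apply, smul_eq_mul] at h
  refine h.trans (congrArg (Cochain.eval · S.fundamentalCycle) (funext fun t => ?_))
  have hφ : (fun e => φ e * x t) = x t • φ := funext fun e => mul_comm _ _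
  rw [hφ, map_smul, Pi.smul_apply, smul_eq_mul, Pi.mul_apply]

theorem fundamentalCycle_ne_zero (t : Simplex S.K 2) : (S.fundamentalCycle t : ℂ) ≠ 0 := by
  obtain h | h := S.fundamentalCycle_coeff t <;> simp [h]

theorem coboundary_eq_zero_of_forall_dotProduct {φ : Cochain S.K 1}
    (h : ∀ x, φ ⬝ᵥ fundamentalBoundary S x = 0) : coboundary S.K 1 φ = 0 := by
  funext t
  have hterm : (S.fundamentalCycle t : ℂ) * coboundary S.K 1 φ t = 0 := by
    have ht := h (Pi.single t 1)
    rwa [dotProduct_fundamentalBoundary, Cochain.eval, Fintype.sum_eq_single t fun u hu => by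
      simp [hu], Pi.mul_apply, Pi.single_eq_same, one_mul] at ht
  exact (mul_eq_zero.1 hterm).resolve_left (fundamentalCycle_ne_zero S t)

end FundamentalBoundary

section PoincareDuality

variable {V : Type*} [Fintype V] [LinearOrder V] {S : TriangulatedSurface V}

theorem ncard_triangles_le_two (e : Simplex S.K 1) :
    {t : Simplex S.K 2 | e.1 ⊆ t.1}.ncard ≤ 2 := by
  obtain ⟨v, hv⟩ : ∃ v, v ∈ e.1 := ⟨_, e.vertex_mem 0⟩
  obtain ⟨w, h, rfl⟩ := Simplex.exists_eq_edge hv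
  have hsub : Subtype.val '' {t : Simplex S.K 2 | {v, w} ⊆ t.1} ⊆
      (fun z => {v, w, z.1}) '' (linkGraph S.K v).neighborSet ⟨w, h⟩ := by
    rintro _ ⟨t, ht, rfl⟩
    obtain ⟨z, hz, hzt⟩ := Finset.exists_eq_insert_iff.2
      ⟨ht, by rw [Finset.card_pair h.1, t.2.2]⟩
    have ht' : {v, w, z} = t.1 := by rw [← hzt, Finset.insert_comm z, Finset.pair_comm z]
    rw [Finset.mem_insert, Finset.mem_singleton, not_or] at hz
    have hvz : {v, z} ∈ S.K.faces :=
      (S.K.isRelLowerSet_faces t.2.1).2 (by rw [← ht']; grind) (Finset.insert_nonempty _ _)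
    exact ⟨⟨z, Ne.symm hz.1, hvz⟩, ⟨fun hwz => hz.2 (congrArg Subtype.val hwz).symm,
      ht' ▸ t.2.1⟩, ht'⟩
  calc {t : Simplex S.K 2 | {v, w} ⊆ t.1}.ncard
      = (Subtype.val '' {t : Simplex S.K 2 | {v, w} ⊆ t.1}).ncard :=
        (Set.ncard_image_of_injective _ Subtype.val_injective).symm
    _ ≤ ((linkGraph S.K v).neighborSet ⟨w, h⟩).ncard :=
        (Set.ncard_le_ncard hsub (Set.toFinite _)).trans (Set.ncard_image_le (Set.toFinite _))
    _ = 2 := S.link_degree v ⟨w, h⟩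

theorem exists_forall_eq_of_fundamentalBoundary_eq_zero {x : Cochain S.K 2} {e : Simplex S.K 1}
    (hx : fundamentalBoundary S x e = 0) : ∃ z, ∀ t : Simplex S.K 2, e.1 ⊆ t.1 → x t = z := by
  by_cases hne : ∃ t' : Simplex S.K 2, e.1 ⊆ t'.1
  swap
  · exact ⟨0, fun t ht => absurd ⟨t, ht⟩ hne⟩
  obtain ⟨t', ht'⟩ := hne
  refine ⟨x t', fun t ht => by_contra fun hxt => ?_⟩
  have htt' : t ≠ t' := fun h => hxt (congrArg x h)
  have hother : ∀ u : Simplex S.K 2, e.1 ⊆ u.1 → u ≠ t → u = t' := fun u hu hut =>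
    by_contra fun hut' => (ncard_triangles_le_two e).not_gt <|
      (Set.two_lt_ncard_iff (Set.toFinite _)).2 ⟨u, t, t', hu, ht, ht', hut, hut', htt'⟩
  have hsub : fundamentalBoundary S (x - fun _ => x t') e = 0 := by
    rw [map_sub, fundamentalBoundary_const, sub_zero, hx]
  have hterm : (S.fundamentalCycle t : ℂ) *
      ((x t - x t') * coboundary S.K 1 (Pi.single e 1) t) = 0 := by
    refine (Fintype.sum_eq_single t fun u hu => ?_).symm.trans hsub
    by_cases heu : e.1 ⊆ u.1
    · simp [hother u heu hu]
    · simp [coboundary_single_of_not_subset heu]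
  have hcoeff := left_ne_zero_of_mul_eq_one (coboundary_single_mul_self ht)
  exact mul_ne_zero (fundamentalCycle_ne_zero S t) (mul_ne_zero (sub_ne_zero.2 hxt) hcoeff) hterm

theorem apply_edge_mul_eq_of_reachable {φ : Cochain S.K 1} (hφ : coboundary S.K 1 φ = 0) {v : V}
    (hv : ∀ e : Simplex S.K 1, ¬(Simplex.point S.K v).1 ⊆ e.1 → φ e = 0)
    {w w' : {w : V // v ≠ w ∧ {v, w} ∈ S.K.faces}} (h : (linkGraph S.K v).Reachable w w') :
    φ (Simplex.edge v w w.2) *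
        coboundary S.K 0 (Pi.single (Simplex.point S.K v) 1) (Simplex.edge v w w.2) =
      φ (Simplex.edge v w' w'.2) *
        coboundary S.K 0 (Pi.single (Simplex.point S.K v) 1) (Simplex.edge v w' w'.2) := by
  obtain ⟨q⟩ := h
  induction q with
  | nil => rfl
  | @cons w w' _ hadj _ ih =>
    have hcard : ({v, w.1, w'.1} : Finset V).card = 3 :=
      Finset.card_eq_three.2 ⟨v, w, w', w.2.1, w'.2.1, fun h => hadj.1 (Subtype.ext h), rfl⟩
    refine (mul_coboundary_single_eq_of_subset hφ hv (t := ⟨_, hadj.2, hcard⟩)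
      ?_ ?_ ?_ ?_).trans ih <;> simp only [Simplex.edge, Simplex.point] <;> grind

theorem exists_eq_smul_coboundary_single {φ : Cochain S.K 1} (hφ : coboundary S.K 1 φ = 0)
    {p : Simplex S.K 0} (hp : ∀ e : Simplex S.K 1, ¬p.1 ⊆ e.1 → φ e = 0) :
    ∃ r : ℂ, φ = r • coboundary S.K 0 (Pi.single p 1) := by
  obtain ⟨v, rfl⟩ := p.exists_eq_point
  obtain ⟨w₀⟩ := (S.link_connected v).nonempty
  refine ⟨φ (Simplex.edge v w₀ w₀.2) *
    coboundary S.K 0 (Pi.single (Simplex.point S.K v) 1) (Simplex.edge v w₀ w₀.2),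
    funext fun e => ?_⟩
  rw [Pi.smul_apply, smul_eq_mul]
  by_cases he : (Simplex.point S.K v).1 ⊆ e.1
  · obtain ⟨w, h, rfl⟩ := Simplex.exists_eq_edge (Finset.singleton_subset_iff.1 he)
    rw [apply_edge_mul_eq_of_reachable hφ hp ((S.link_connected v).preconnected w₀ ⟨w, h⟩),
      mul_assoc, coboundary_single_mul_self he, mul_one]
  · rw [hp e he, coboundary_single_of_not_subset he, mul_zero]

theorem exists_fundamentalBoundary_eqOn_star {c : Chain S.K 1} (hc : boundary S.K 0 c = 0)
    (p : Simplex S.K 0) :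
    ∃ x, ∀ e : Simplex S.K 1, p.1 ⊆ e.1 → fundamentalBoundary S x e = -c e := by
  refine exists_eqOn_of_forall_dotProduct_eq_zero (fundamentalBoundary S) (fun e => -(c e : ℂ))
    {e | p.1 ⊆ e.1} fun φ hp hφ => ?_
  obtain ⟨r, rfl⟩ :=
    exists_eq_smul_coboundary_single (coboundary_eq_zero_of_forall_dotProduct S hφ) hp
  have hcp : coboundary S.K 0 (Pi.single p 1) ⬝ᵥ (fun e => (c e : ℂ)) = 0 :=
    (dotProduct_comm _ _).trans (Cochain.eval_coboundary_of_boundary_eq_zero (Pi.single p 1) hc)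
  rw [smul_dotProduct, ← Pi.neg_def, dotProduct_neg, hcp, neg_zero, smul_zero]

theorem exists_isPoincareDual {c : Chain S.K 1} (hc : boundary S.K 0 c = 0) :
    ∃ η, IsPoincareDual S η c := by
  choose d hd using exists_fundamentalBoundary_eqOn_star hc
  have hη : ∀ e : Simplex S.K 1, ∃ z, ∀ t : Simplex S.K 2, e.1 ⊆ t.1 →
      coboundary S.K 0 (fun p => d p t) e = z := fun e => by
    simp only [coboundary_edge_apply]
    refine exists_forall_eq_of_fundamentalBoundary_eq_zero (x := d (e.face 0) - d (e.face 1)) ?_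
    rw [map_sub, Pi.sub_apply, hd _ e (e.face_subset 0), hd _ e (e.face_subset 1), sub_self]
  choose η hη using hη
  have hface : ∀ t i, η (t.face i) = coboundary S.K 0 (fun p => d p t) (t.face i) :=
    fun t i => (hη _ t (t.face_subset i)).symm
  refine ⟨η, funext fun t => ?_, fun α hα => ?_⟩
  · simp_rw [coboundary_apply η, hface]
    exact congrFun (coboundary_coboundary fun p => d p t) t
  · let x : Simplex S.K 1 → Cochain S.K 2 := fun e => α e • (d (e.face 0) + d (e.face 1))
    have hcup : cup α η = (-(1 / 2) : ℂ) • fun t => coboundary S.K 1 (fun e => x e t) t :=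
      funext fun t => by
        rw [cup_apply_eq_coboundary (congrFun hα t) (fun p => d p t) (hface t)]
        rfl
    rw [hcup, Cochain.eval_smul, ← sum_fundamentalBoundary, Cochain.eval, Finset.mul_sum]
    refine Finset.sum_congr rfl fun e _ => ?_
    simp only [x]
    rw [map_smul, map_add, Pi.smul_apply, Pi.add_apply, hd _ e (e.face_subset 0),
      hd _ e (e.face_subset 1), smul_eq_mul]
    ring

end PoincareDuality

section Harmonic

variable {V : Type*}

theorem CochainInnerProduct.eq_zero_of_form_self {K : AbstractSimplicialComplex V}
    (ip : CochainInnerProduct K) {j : ℕ} {α : Cochain K j} (h : ip.form j α α = 0) : α = 0 := by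
  by_contra hα
  have hpos := ip.pos j α hα
  rw [h, Complex.zero_re] at hpos
  exact hpos.false

variable [Fintype V] [LinearOrder V]

namespace CochainInnerProduct

variable {K : AbstractSimplicialComplex V} (ip : CochainInnerProduct K)

theorem codifferential_eq_zero_iff {j : ℕ} {α : Cochain K (j + 1)} :
    ip.codifferential j α = 0 ↔ ∀ f : Cochain K j, ip.form (j + 1) α (coboundary K j f) = 0 := by
  simp only [← form_codifferential]
  exact ⟨fun h f => by rw [h, map_zero, LinearMap.zero_apply],
    fun h => ip.eq_zero_of_form_self (h _)⟩

theorem mem_harmonic_iff {σ : Cochain K 1} : σ ∈ ip.harmonic ↔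
    coboundary K 1 σ = 0 ∧ ∀ f : Cochain K 0, ip.form 1 σ (coboundary K 0 f) = 0 := by
  simp only [harmonic, Submodule.mem_inf, LinearMap.mem_ker, ← codifferential_eq_zero_iff]
  refine ⟨fun h => ⟨h.1.2, h.2⟩, fun h => ⟨⟨?_, h.1⟩, h.2⟩⟩
  simp [laplacian, h.1, h.2]

theorem exists_sub_coboundary_mem_harmonic {η : Cochain K 1} (hη : coboundary K 1 η = 0) :
    ∃ f : Cochain K 0, η - coboundary K 0 f ∈ ip.harmonic := by
  let R := LinearMap.range (coboundary K 0)
  obtain ⟨⟨_, f, rfl⟩, hf⟩ := (riesz_bijective ((ip.form 1).domRestrict₁₂ R R)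
    (fun a b => ip.conj_symm 1 a b) fun a ha => ip.pos 1 a (Subtype.coe_ne_coe.2 ha)).2
      ((ip.form 1 η).domRestrict R)
  refine ⟨f, ip.mem_harmonic_iff.2 ⟨by rw [map_sub, hη, coboundary_coboundary, sub_zero],
    fun h => ?_⟩⟩
  rw [map_sub, LinearMap.sub_apply, sub_eq_zero]
  exact (LinearMap.congr_fun hf ⟨_, h, rfl⟩).symm

theorem coboundary_eq_zero_of_mem_harmonic {f : Cochain K 0} (h : coboundary K 0 f ∈ ip.harmonic) :
    coboundary K 0 f = 0 :=
  ip.eq_zero_of_form_self ((ip.mem_harmonic_iff.1 h).2 f)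

theorem star_mem_harmonic (hreal : ip.IsReal) {σ : Cochain K 1} (h : σ ∈ ip.harmonic) :
    star σ ∈ ip.harmonic := by
  rw [mem_harmonic_iff] at h ⊢
  refine ⟨by rw [coboundary_star, h.1, star_zero], fun f => ?_⟩
  have hf := hreal σ (coboundary K 0 (star f))
  rwa [h.2, ← coboundary_star, star_star, map_zero] at hf

/-- Complex conjugation of harmonic cochains. -/
noncomputable def harmonicConj (hreal : ip.IsReal) : ip.harmonic →ₗ⋆[ℂ] ip.harmonic where
  toFun σ := ⟨star σ.1, ip.star_mem_harmonic hreal σ.2⟩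
  map_add' σ τ := Subtype.ext (star_add σ.1 τ.1)
  map_smul' r σ := Subtype.ext (star_smul r σ.1)

theorem coe_harmonicConj (hreal : ip.IsReal) (σ : ip.harmonic) :
    (ip.harmonicConj hreal σ : Cochain K 1) = star σ.1 :=
  rfl

theorem harmonicForm_apply (σ τ : ip.harmonic) : ip.harmonicForm σ τ = ip.form 1 σ.1 τ.1 :=
  rfl

theorem conj_harmonicForm (σ τ : ip.harmonic) :
    conj (ip.harmonicForm τ σ) = ip.harmonicForm σ τ :=
  ip.conj_symm 1 _ _

theorem re_harmonicForm_self_pos (σ : ip.harmonic) (hσ : σ ≠ 0) : 0 < (ip.harmonicForm σ σ).re :=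
  ip.pos 1 _ (Subtype.coe_ne_coe.2 hσ)

theorem harmonicForm_harmonicConj (hreal : ip.IsReal) (σ τ : ip.harmonic) :
    ip.harmonicForm (ip.harmonicConj hreal σ) τ =
      conj (ip.harmonicForm σ (ip.harmonicConj hreal τ)) := by
  rw [harmonicForm_apply, harmonicForm_apply, coe_harmonicConj, coe_harmonicConj, ← hreal,
    star_star]

end CochainInnerProduct

variable (S : TriangulatedSurface V) (ip : CochainInnerProduct S.K)

/-- The operator `i ★` on harmonic cochains. It is self-adjoint, and the eigenvalue equation
`★ σ = -i λ σ` becomes `i ★ σ = λ σ`. -/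
noncomputable def selfAdjointStar : Module.End ℂ ip.harmonic :=
  Complex.I • harmonicStar S ip

theorem harmonicForm_selfAdjointStar (σ τ : ip.harmonic) :
    ip.harmonicForm (selfAdjointStar S ip σ) τ = Complex.I * cupPairing S σ (star τ.1) := by
  rw [selfAdjointStar, LinearMap.smul_apply, map_smul, LinearMap.smul_apply, smul_eq_mul,
    ip.harmonicForm_apply, harmonicStar, LinearMap.comp_apply, ip.form_harmonicProjection]
  exact congrArg _ (form_combinatorialStar S ip σ τ)

theorem harmonicForm_selfAdjointStar_swap (σ τ : ip.harmonic) :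
    ip.harmonicForm (selfAdjointStar S ip σ) τ = ip.harmonicForm σ (selfAdjointStar S ip τ) := by
  rw [← ip.conj_harmonicForm σ, harmonicForm_selfAdjointStar, harmonicForm_selfAdjointStar,
    map_mul, ← cupPairing_star, star_star, Complex.conj_I, cupPairing_swap]
  ring

theorem selfAdjointStar_harmonicConj (hreal : ip.IsReal) (σ : ip.harmonic) :
    selfAdjointStar S ip (ip.harmonicConj hreal σ) =
      -ip.harmonicConj hreal (selfAdjointStar S ip σ) := by
  apply ip.harmonicForm_bijective.1
  ext τ
  rw [map_neg, LinearMap.neg_apply, harmonicForm_selfAdjointStar, ip.harmonicForm_harmonicConj,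
    harmonicForm_selfAdjointStar, ip.coe_harmonicConj, ip.coe_harmonicConj, star_star, map_mul,
    cupPairing_star, Complex.conj_I]
  ring

theorem eq_zero_of_forall_cupPairing_eq_zero {σ : Cochain S.K 1} (hσ : σ ∈ ip.harmonic)
    (h : ∀ τ ∈ ip.harmonic, cupPairing S σ τ = 0) : σ = 0 := by
  have hclosed := (ip.mem_harmonic_iff.1 hσ).1
  obtain ⟨f, rfl⟩ := exists_eq_coboundary_of_eval_eq_zero S.connected fun z hz => by
    obtain ⟨η, hη, hdual⟩ := exists_isPoincareDual hz
    obtain ⟨f, hf⟩ := ip.exists_sub_coboundary_mem_harmonic hη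
    have hpair := h _ hf
    rw [map_sub, cupPairing_coboundary S hclosed, sub_zero] at hpair
    exact (hdual σ hclosed).trans hpair
  exact ip.coboundary_eq_zero_of_mem_harmonic hσ

theorem selfAdjointStar_injective (hreal : ip.IsReal) :
    Function.Injective (selfAdjointStar S ip) := by
  refine (injective_iff_map_eq_zero _).2 fun σ hσ =>
    Subtype.ext (eq_zero_of_forall_cupPairing_eq_zero S ip σ.2 fun τ hτ => ?_)
  have h := harmonicForm_selfAdjointStar S ip σ (ip.harmonicConj hreal ⟨τ, hτ⟩)
  rw [hσ, map_zero, LinearMap.zero_apply, ip.coe_harmonicConj, star_star] at h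
  exact (mul_eq_zero.1 h.symm).resolve_left Complex.I_ne_zero

theorem mem_eigenspace_selfAdjointStar_iff {σ : ip.harmonic} {l : ℂ} :
    σ ∈ (selfAdjointStar S ip).eigenspace l ↔
      (harmonicStar S ip σ : Cochain S.K 1) = (-(Complex.I * l)) • σ.1 := by
  rw [Module.End.mem_eigenspace_iff, selfAdjointStar, LinearMap.smul_apply, ← Submodule.coe_smul,
    Subtype.coe_inj, ← smul_right_inj (neg_ne_zero.2 Complex.I_ne_zero), smul_smul, smul_smul,
    neg_mul, neg_mul, Complex.I_mul_I, neg_neg, one_smul]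

theorem holomorphicCochains_eq_map : holomorphicCochains S ip =
    (nonnegEigenspan (selfAdjointStar S ip)).map ip.harmonic.subtype := by
  apply le_antisymm
  · refine Submodule.span_le.2 ?_
    rintro σ ⟨hσ, l, hl, hstar⟩
    exact ⟨⟨σ, hσ⟩, Submodule.mem_iSup_of_mem ⟨l, hl⟩
      ((mem_eigenspace_selfAdjointStar_iff S ip).2 hstar), rfl⟩
  · refine Submodule.map_le_iff_le_comap.2 (iSup_le fun l σ hσ => Submodule.subset_span ?_)
    exact ⟨σ.2, l, l.2, (mem_eigenspace_selfAdjointStar_iff S ip).1 hσ⟩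

variable {S ip}

theorem mem_harmonic_of_mem_holomorphicCochains {σ : Cochain S.K 1}
    (hσ : σ ∈ holomorphicCochains S ip) : σ ∈ ip.harmonic := by
  rw [holomorphicCochains_eq_map] at hσ
  exact Submodule.map_subtype_le _ _ hσ

theorem coboundary_eq_zero_of_mem_holomorphicCochains {σ : Cochain S.K 1}
    (hσ : σ ∈ holomorphicCochains S ip) : coboundary S.K 1 σ = 0 :=
  (ip.mem_harmonic_iff.1 (mem_harmonic_of_mem_holomorphicCochains hσ)).1

theorem cupPairing_eq_zero_of_mem_holomorphicCochains (hreal : ip.IsReal) {σ τ : Cochain S.K 1}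
    (hσ : σ ∈ holomorphicCochains S ip) (hτ : τ ∈ holomorphicCochains S ip) :
    cupPairing S σ τ = 0 := by
  rw [holomorphicCochains_eq_map] at hσ hτ
  obtain ⟨σ, hσ, rfl⟩ := hσ
  obtain ⟨τ, hτ, rfl⟩ := hτ
  have hconj : ip.harmonicConj hreal τ ∈ nonnegEigenspan (-selfAdjointStar S ip) :=
    map_mem_nonnegEigenspan (fun ρ => by
      rw [LinearMap.neg_apply, selfAdjointStar_harmonicConj, neg_neg]) hτ
  have h := form_apply_eq_zero_of_mem_nonnegEigenspan_neg
    (harmonicForm_selfAdjointStar_swap S ip) hσ hconj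
  rw [harmonicForm_selfAdjointStar, ip.coe_harmonicConj, star_star] at h
  exact (mul_eq_zero.1 h).resolve_left Complex.I_ne_zero

theorem re_I_mul_cupPairing_star_pos (hreal : ip.IsReal) {σ : Cochain S.K 1}
    (hσ : σ ∈ holomorphicCochains S ip) (hσ0 : σ ≠ 0) :
    0 < (Complex.I * cupPairing S σ (star σ)).re := by
  rw [holomorphicCochains_eq_map] at hσ
  obtain ⟨σ, hσ, rfl⟩ := hσ
  have h := re_form_apply_pos_of_mem_nonnegEigenspan ip.re_harmonicForm_self_pos
    (harmonicForm_selfAdjointStar_swap S ip) (selfAdjointStar_injective S ip hreal) hσ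
    (Subtype.coe_ne_coe.1 hσ0)
  rwa [harmonicForm_selfAdjointStar] at h

theorem exists_eq_add_star_of_mem_harmonic (hreal : ip.IsReal) {τ : Cochain S.K 1}
    (hτ : τ ∈ ip.harmonic) : ∃ τ₁ ∈ holomorphicCochains S ip, ∃ τ₂ ∈ holomorphicCochains S ip,
      τ = τ₁ + star τ₂ := by
  have htop := nonnegEigenspan_sup_nonnegEigenspan_neg ip.conj_harmonicForm
    ip.re_harmonicForm_self_pos (harmonicForm_selfAdjointStar_swap S ip)
  obtain ⟨τ₁, h₁, τ₂, h₂, hadd⟩ := Submodule.mem_sup.1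
    (htop ▸ Submodule.mem_top : (⟨τ, hτ⟩ : ip.harmonic) ∈ _)
  have hconj : ip.harmonicConj hreal τ₂ ∈ nonnegEigenspan (selfAdjointStar S ip) :=
    map_mem_nonnegEigenspan (fun ρ => by
      rw [selfAdjointStar_harmonicConj, LinearMap.neg_apply, map_neg]) h₂
  simp only [holomorphicCochains_eq_map]
  refine ⟨τ₁, Submodule.mem_map_of_mem h₁, _, Submodule.mem_map_of_mem hconj, ?_⟩
  rw [Submodule.subtype_apply, ip.coe_harmonicConj, star_star]
  exact (congrArg Subtype.val hadd).symm

theorem mem_holomorphicCochains_of_forall_cupPairing_eq_zero (hreal : ip.IsReal)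
    {τ : Cochain S.K 1} (hτ : τ ∈ ip.harmonic)
    (h : ∀ σ ∈ holomorphicCochains S ip, cupPairing S σ τ = 0) :
    τ ∈ holomorphicCochains S ip := by
  obtain ⟨τ₁, h₁, τ₂, h₂, rfl⟩ := exists_eq_add_star_of_mem_harmonic hreal hτ
  have hpair := h τ₂ h₂
  rw [map_add, cupPairing_eq_zero_of_mem_holomorphicCochains hreal h₂ h₁, zero_add] at hpair
  obtain rfl : τ₂ = 0 := by
    by_contra hτ₂
    simpa [hpair] using re_I_mul_cupPairing_star_pos hreal h₂ hτ₂
  rwa [star_zero, add_zero]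

end Harmonic

section Periods

variable {V : Type*} [Fintype V] [LinearOrder V] {S : TriangulatedSurface V} {g : ℕ}
  {a b : Fin g → Chain S.K 1}

namespace IsCanonicalHomologyBasis

theorem boundary_left (hab : IsCanonicalHomologyBasis S a b) (i : Fin g) :
    boundary S.K 0 (a i) = 0 :=
  hab.isHomologyBasis.1 (Sum.inl i)

theorem boundary_right (hab : IsCanonicalHomologyBasis S a b) (i : Fin g) :
    boundary S.K 0 (b i) = 0 :=
  hab.isHomologyBasis.1 (Sum.inr i)

theorem exists_eq_coboundary (hab : IsCanonicalHomologyBasis S a b) {α : Cochain S.K 1}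
    (hα : coboundary S.K 1 α = 0) (ha : ∀ i, α.eval (a i) = 0) (hb : ∀ i, α.eval (b i) = 0) :
    ∃ f : Cochain S.K 0, α = coboundary S.K 0 f := by
  refine exists_eq_coboundary_of_eval_eq_zero S.connected fun z hz => ?_
  obtain ⟨n, ⟨d, hd⟩, -⟩ := hab.isHomologyBasis.2 z hz
  have hperiods : ∀ k, α.eval (Sum.elim a b k) = 0 := Sum.rec ha hb
  have h := Cochain.eval_coboundary α d
  rw [hα, ← hd, Cochain.eval_sub_right, Cochain.eval_sum_zsmul_right] at h
  simp only [hperiods, mul_zero, Finset.sum_const_zero, sub_zero] at h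
  exact h.symm.trans (by simp [Cochain.eval])

theorem exists_closed_eval_eq (hab : IsCanonicalHomologyBasis S a b) (x y : Fin g → ℂ) :
    ∃ β : Cochain S.K 1, coboundary S.K 1 β = 0 ∧ (∀ i, β.eval (a i) = x i) ∧
      (∀ i, β.eval (b i) = y i) ∧ ∀ α, coboundary S.K 1 α = 0 →
        cupPairing S α β = ∑ k, (α.eval (a k) * y k - α.eval (b k) * x k) := by
  choose ηa ha using fun i => exists_isPoincareDual (hab.boundary_left i)
  choose ηb hb using fun i => exists_isPoincareDual (hab.boundary_right i)
  let β := ∑ k, (y k • ηa k - x k • ηb k)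
  have hβ : coboundary S.K 1 β = 0 := by
    simp only [β, map_sum, map_sub, map_smul, (ha _).1, (hb _).1, smul_zero, sub_zero,
      Finset.sum_const_zero]
  have hpair : ∀ α, coboundary S.K 1 α = 0 →
      cupPairing S α β = ∑ k, (α.eval (a k) * y k - α.eval (b k) * x k) := fun α hα => by
    simp only [β, map_sum, map_sub, map_smul, smul_eq_mul, cupPairing_apply, ← (ha _).2 α hα,
      ← (hb _).2 α hα, mul_comm]
  refine ⟨β, hβ, fun i => ?_, fun i => ?_, hpair⟩
  · have haa : ∀ k, (ηa i).eval (a k) = 0 := fun k => by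
      rw [(ha k).2 _ (ha i).1, hab.inter_aa i k _ _ (ha i) (ha k), Int.cast_zero]
    have hab' : ∀ k, (ηa i).eval (b k) = if i = k then 1 else 0 := fun k => by
      rw [(hb k).2 _ (ha i).1, hab.inter_ab i k _ _ (ha i) (hb k), Int.cast_ite, Int.cast_one,
        Int.cast_zero]
    rw [(ha i).2 β hβ, ← cupPairing_apply, cupPairing_swap, hpair _ (ha i).1]
    simp [haa, hab']
  · have hba : ∀ k, (ηb i).eval (a k) = -if k = i then 1 else 0 := fun k => by
      rw [(ha k).2 _ (hb i).1, ← cupPairing_apply, cupPairing_swap, cupPairing_apply,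
        hab.inter_ab k i _ _ (ha k) (hb i), Int.cast_ite, Int.cast_one, Int.cast_zero]
    have hbb : ∀ k, (ηb i).eval (b k) = 0 := fun k => by
      rw [(hb k).2 _ (hb i).1, hab.inter_bb i k _ _ (hb i) (hb k), Int.cast_zero]
    rw [(hb i).2 β hβ, ← cupPairing_apply, cupPairing_swap, hpair _ (hb i).1]
    simp [hba, hbb]

theorem cupPairing_eq (hab : IsCanonicalHomologyBasis S a b) {α β : Cochain S.K 1}
    (hα : coboundary S.K 1 α = 0) (hβ : coboundary S.K 1 β = 0) :
    cupPairing S α β = ∑ k, (α.eval (a k) * β.eval (b k) - α.eval (b k) * β.eval (a k)) := by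
  obtain ⟨β', hβ', ha, hb, hpair⟩ :=
    hab.exists_closed_eval_eq (fun k => β.eval (a k)) fun k => β.eval (b k)
  obtain ⟨f, hf⟩ := hab.exists_eq_coboundary (α := β - β') (by rw [map_sub, hβ, hβ', sub_zero])
    (fun i => by rw [Cochain.eval_sub, ha, sub_self])
    fun i => by rw [Cochain.eval_sub, hb, sub_self]
  rw [← hpair α hα, ← sub_eq_zero, ← map_sub, hf, cupPairing_coboundary S hα]

theorem exists_mem_harmonic_eval_eq (hab : IsCanonicalHomologyBasis S a b)
    (ip : CochainInnerProduct S.K) (x y : Fin g → ℂ) :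
    ∃ τ ∈ ip.harmonic, (∀ i, τ.eval (a i) = x i) ∧ ∀ i, τ.eval (b i) = y i := by
  obtain ⟨β, hβ, ha, hb, -⟩ := hab.exists_closed_eval_eq x y
  obtain ⟨f, hf⟩ := ip.exists_sub_coboundary_mem_harmonic hβ
  refine ⟨_, hf, fun i => ?_, fun i => ?_⟩
  · rw [Cochain.eval_sub, ha, Cochain.eval_coboundary_of_boundary_eq_zero f (hab.boundary_left i),
      sub_zero]
  · rw [Cochain.eval_sub, hb, Cochain.eval_coboundary_of_boundary_eq_zero f (hab.boundary_right i),
      sub_zero]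

end IsCanonicalHomologyBasis

variable {ip : CochainInnerProduct S.K}

theorem sum_im_conj_aPeriod_mul_bPeriod_pos (hreal : ip.IsReal)
    (hab : IsCanonicalHomologyBasis S a b) {σ : Cochain S.K 1}
    (hσ : σ ∈ holomorphicCochains S ip) (hσ0 : σ ≠ 0) :
    0 < ∑ k, (conj (σ.eval (a k)) * σ.eval (b k)).im := by
  have hclosed := coboundary_eq_zero_of_mem_holomorphicCochains hσ
  have hpos := re_I_mul_cupPairing_star_pos hreal hσ hσ0
  rw [hab.cupPairing_eq hclosed (by rw [coboundary_star, hclosed, star_zero]), Complex.I_mul_re,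
    Complex.im_sum, ← Finset.sum_neg_distrib] at hpos
  have hterm : ∀ z w : ℂ, -(z * conj w - w * conj z).im = 2 * (conj z * w).im := fun z w => by
    simp only [Complex.sub_im, Complex.mul_im, Complex.conj_re, Complex.conj_im]
    ring
  simp only [Cochain.eval_star, hterm, ← Finset.mul_sum] at hpos
  exact pos_of_mul_pos_right hpos zero_le_two

theorem eq_zero_of_aPeriods_eq_zero (hreal : ip.IsReal) (hab : IsCanonicalHomologyBasis S a b)
    {σ : Cochain S.K 1} (hσ : σ ∈ holomorphicCochains S ip) (h : ∀ i, σ.eval (a i) = 0) :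
    σ = 0 := by
  by_contra hσ0
  simpa [h] using sum_im_conj_aPeriod_mul_bPeriod_pos hreal hab hσ hσ0

variable (ip) in
/-- The `A`-periods `σ(aᵢ)` of a holomorphic cochain `σ`. -/
noncomputable def aPeriodMap (a : Fin g → Chain S.K 1) :
    holomorphicCochains S ip →ₗ[ℂ] Fin g → ℂ where
  toFun σ i := σ.1.eval (a i)
  map_add' _ _ := funext fun _ => Cochain.eval_add _ _ _
  map_smul' _ _ := funext fun _ => Cochain.eval_smul _ _ _

theorem aPeriodMap_apply (σ : holomorphicCochains S ip) (i : Fin g) :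
    aPeriodMap ip a σ i = σ.1.eval (a i) :=
  rfl

theorem aPeriodMap_injective (hreal : ip.IsReal) (hab : IsCanonicalHomologyBasis S a b) :
    Function.Injective (aPeriodMap ip a) :=
  (injective_iff_map_eq_zero _).2 fun σ hσ =>
    Subtype.ext (eq_zero_of_aPeriods_eq_zero hreal hab σ.2 (congrFun hσ))

theorem aPeriodMap_surjective (hreal : ip.IsReal) (hab : IsCanonicalHomologyBasis S a b) :
    Function.Surjective (aPeriodMap ip a) := by
  have hker : ∀ φ : Fin g → ℂ, (∀ σ, φ ⬝ᵥ aPeriodMap ip a σ = 0) → φ = 0 := fun φ hφ => by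
    obtain ⟨τ, hτ, ha, hb⟩ := hab.exists_mem_harmonic_eval_eq ip 0 φ
    have hhol : τ ∈ holomorphicCochains S ip :=
      mem_holomorphicCochains_of_forall_cupPairing_eq_zero hreal hτ fun σ hσ => by
        rw [hab.cupPairing_eq (coboundary_eq_zero_of_mem_holomorphicCochains hσ)
          (ip.mem_harmonic_iff.1 hτ).1, ← hφ ⟨σ, hσ⟩]
        simp only [dotProduct, ha, hb, Pi.zero_apply, zero_mul, sub_zero, aPeriodMap_apply,
          mul_comm]
    funext i
    rw [← hb, eq_zero_of_aPeriods_eq_zero hreal hab hhol ha]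
    simp [Cochain.eval]
  intro y
  obtain ⟨σ, hσ⟩ := exists_eqOn_of_forall_dotProduct_eq_zero (aPeriodMap ip a) y Set.univ
    fun φ _ hφ => by rw [hker φ hφ, zero_dotProduct]
  exact ⟨σ, funext fun i => hσ (Set.mem_univ i)⟩

namespace IsCanonicalHolomorphicBasis

variable {σ : Fin g → Cochain S.K 1}

theorem mem (hσ : IsCanonicalHolomorphicBasis S ip a σ) (i : Fin g) :
    σ i ∈ holomorphicCochains S ip :=
  hσ.span_eq ▸ Submodule.subset_span ⟨i, rfl⟩

theorem aPeriodMap_eq_single (hσ : IsCanonicalHolomorphicBasis S ip a σ) (i : Fin g) :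
    aPeriodMap ip a ⟨σ i, hσ.mem i⟩ = Pi.single i 1 :=
  funext fun j => by rw [aPeriodMap_apply, hσ.aPeriods, Pi.single_apply, if_congr eq_comm rfl rfl]

theorem eval_sum_smul (hσ : IsCanonicalHolomorphicBasis S ip a σ) (x : Fin g → ℂ) (j : Fin g) :
    (∑ i, x i • σ i).eval (a j) = x j := by
  simp [Cochain.eval_sum, Cochain.eval_smul, hσ.aPeriods]

end IsCanonicalHolomorphicBasis

theorem isCanonicalHolomorphicBasis_of_basis
    (σ : Module.Basis (Fin g) ℂ (holomorphicCochains S ip))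
    (hσ : ∀ i, aPeriodMap ip a (σ i) = Pi.single i 1) :
    IsCanonicalHolomorphicBasis S ip a fun i => (σ i : Cochain S.K 1) where
  linearIndependent :=
    σ.linearIndependent.map' (holomorphicCochains S ip).subtype (Submodule.ker_subtype _)
  span_eq := by
    have h := congrArg (Submodule.map (holomorphicCochains S ip).subtype) σ.span_eq
    rwa [Submodule.map_span, Submodule.map_subtype_top, ← Set.range_comp] at h
  aPeriods i j := by
    rw [← aPeriodMap_apply, hσ, Pi.single_apply, if_congr eq_comm rfl rfl]

theorem existsUnique_isCanonicalHolomorphicBasis (hreal : ip.IsReal)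
    (hab : IsCanonicalHomologyBasis S a b) :
    ∃! σ : Fin g → Cochain S.K 1, IsCanonicalHolomorphicBasis S ip a σ := by
  have hinj := aPeriodMap_injective hreal hab
  let periods := LinearEquiv.ofBijective (aPeriodMap ip a)
    ⟨hinj, aPeriodMap_surjective hreal hab⟩
  let σ := Module.Basis.ofEquivFun periods
  have hσ : ∀ i, aPeriodMap ip a (σ i) = Pi.single i 1 := fun i => by
    rw [Module.Basis.coe_ofEquivFun]
    exact periods.apply_symm_apply _
  refine ⟨fun i => σ i, isCanonicalHolomorphicBasis_of_basis σ hσ, fun τ hτ => funext fun i => ?_⟩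
  exact congrArg Subtype.val (hinj ((hτ.aPeriodMap_eq_single i).trans (hσ i).symm))

theorem periodMatrix_isSymm (hreal : ip.IsReal) (hab : IsCanonicalHomologyBasis S a b)
    {σ : Fin g → Cochain S.K 1} (hσ : IsCanonicalHolomorphicBasis S ip a σ) :
    (periodMatrix b σ).IsSymm := by
  refine Matrix.IsSymm.ext fun i j => ?_
  have h := hab.cupPairing_eq (coboundary_eq_zero_of_mem_holomorphicCochains (hσ.mem i))
    (coboundary_eq_zero_of_mem_holomorphicCochains (hσ.mem j))
  rw [cupPairing_eq_zero_of_mem_holomorphicCochains hreal (hσ.mem i) (hσ.mem j)] at h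
  simp only [hσ.aPeriods, Finset.sum_sub_distrib, ite_mul, mul_ite, one_mul, mul_one, zero_mul,
    mul_zero, Finset.sum_ite_eq, Finset.mem_univ, if_true] at h
  exact sub_eq_zero.1 h.symm

theorem im_eval_sum_ofReal_smul (x : Fin g → ℝ) (σ : Fin g → Cochain S.K 1) (j : Fin g) :
    ((∑ i, (x i : ℂ) • σ i).eval (b j)).im =
      Matrix.vecMul x ((periodMatrix b σ).map Complex.im) j := by
  simp only [Cochain.eval_sum, Cochain.eval_smul, Complex.im_sum, Complex.im_ofReal_mul]
  rfl

theorem im_periodMatrix_posDef (hreal : ip.IsReal) (hab : IsCanonicalHomologyBasis S a b)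
    {σ : Fin g → Cochain S.K 1} (hσ : IsCanonicalHolomorphicBasis S ip a σ) :
    ((periodMatrix b σ).map Complex.im).PosDef := by
  have hsymm : ((periodMatrix b σ).map Complex.im).IsHermitian :=
    (periodMatrix_isSymm hreal hab hσ).map Complex.im
  refine Matrix.PosDef.of_dotProduct_mulVec_pos hsymm fun x hx => ?_
  have hmem : ∑ i, (x i : ℂ) • σ i ∈ holomorphicCochains S ip :=
    Submodule.sum_mem _ fun i _ => Submodule.smul_mem _ _ (hσ.mem i)
  have hne : ∑ i, (x i : ℂ) • σ i ≠ 0 := fun h => hx (funext fun i =>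
    Complex.ofReal_eq_zero.1 (Fintype.linearIndependent_iff.1 hσ.linearIndependent _ h i))
  have hpos := sum_im_conj_aPeriod_mul_bPeriod_pos hreal hab hmem hne
  simp only [hσ.eval_sum_smul fun i => (x i : ℂ), Complex.conj_ofReal, Complex.im_ofReal_mul,
    im_eval_sum_ofReal_smul] at hpos
  rwa [star_trivial, Matrix.dotProduct_mulVec, dotProduct_comm]

end Periods

/-- For every cochain inner product on a triangulated closed oriented surface and every canonical
homology basis, the canonical basis of the holomorphic `1`-cochains exists and is unique, its period
matrix `Π` is symmetric, and `Im Π` is positive definite. -/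
theorem mainTheorem10 {V : Type*} [Fintype V] [LinearOrder V] (S : TriangulatedSurface V)
    (ip : CochainInnerProduct S.K) (hreal : ip.IsReal) {g : ℕ} (a b : Fin g → Chain S.K 1)
    (hab : IsCanonicalHomologyBasis S a b) :
    (∃! σ : Fin g → Cochain S.K 1, IsCanonicalHolomorphicBasis S ip a σ) ∧
      ∀ σ : Fin g → Cochain S.K 1, IsCanonicalHolomorphicBasis S ip a σ →
        (periodMatrix b σ).IsSymm ∧ ((periodMatrix b σ).map Complex.im).PosDef :=
  ⟨existsUnique_isCanonicalHolomorphicBasis hreal hab, fun _ hσ =>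
    ⟨periodMatrix_isSymm hreal hab hσ, im_periodMatrix_posDef hreal hab hσ⟩⟩
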